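/- Let $\mathbb{B}^n=\{x\in\mathbb{R}^n:\|x\|_2\le 1\}$ and $\Delta^m=\{y\in\mathbb{R}^m_{\ge 0}:\sum_i y_i=1\}$. For $A\in\mathbb{R}^{m\times n}$ let $\|A\|_{2\to\infty}=\max_{i}\big(\sum_j A_{ij}^2\big)^{1/2}$. For $\epsilon>0$, a pair $(x,y)\in\mathbb{B}^n\times\Delta^m$ is an $\epsilon$-solution of the $\ell_2$-$\ell_1$ game $\min_{x\in\mathbb{B}^n}\max_{y\in\Delta^m}y^\top Ax$ if $$\max_{y'\in\Delta^m}(y')^\top Ax-\min_{x'\in\mathbb{B}^n}y^\top Ax'\le\epsilon .$$ The matrix $A$ is accessible only through a matrix-vector oracle which, queried at $(x,y)\in\mathbb{R}^n\times\mathbb{R}^m$, returns $(Ax,A^\top y)$. Each query may depend on the previous answers; only queries are counted, and the computation between queries is unrestricted. **Theorem.** There is a deterministic algorithm that, given $m$, $n$, $\epsilon>0$ and a matrix-vector oracle for $A\in\mathbb{R}^{m\times n}$ with $\|A\|_{2\to\infty}\le 1$, computes an $\epsilon$-solution of the $\ell_2$-$\ell_1$ game using $\tilde O(\epsilon^{-8/9})$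 matrix-vector queries, where $\tilde O$ hides polylogarithmic factors in $\epsilon^{-1}$, $m$ and $n$. That is, there are absolute constants $C>0$ and $k\in\mathbb{N}$ such that for all $m\ge1$, $n\ge0$, $\epsilon>0$ and all such $A$ the algorithm outputs an $\epsilon$-solution after at most $$C\,\epsilon^{-8/9}\,\log^{k}\!\big(2+m+n+1/\epsilon\big)$$ queries. -/

import Mathlib

namespace MatVecGame

open Matrix

/-- The bilinear form `f_A(x, y) = yᵀ A x`. -/
def bilin {m n : ℕ} (A : Matrix (Fin m) (Fin n) ℝ) (x : Fin n → ℝ) (y : Fin m → ℝ) : ℝ :=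
  y ⬝ᵥ (A *ᵥ x)

/-- The closed Euclidean unit ball of `ℝⁿ`. -/
def unitBall (n : ℕ) : Set (Fin n → ℝ) :=
  {x | ‖WithLp.toLp 2 x‖ ≤ 1}

/-- The norm `‖A‖_{2 → ∞}`: the largest Euclidean norm of a row of `A`. -/
noncomputable def twoToInftyNorm {m n : ℕ} (A : Matrix (Fin m) (Fin n) ℝ) : ℝ :=
  ⨆ i, √(∑ j, A i j ^ 2)

/-- `gap(x, y) = max_{y' ∈ Y} f(x, y') - min_{x' ∈ X} f(x', y)`.  It is used only for continuous
`f` and non-empty compact `X`, `Y`, where the supremum and the infimum are attained. -/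
noncomputable def gap {m n : ℕ} (X : Set (Fin n → ℝ)) (Y : Set (Fin m → ℝ))
    (f : (Fin n → ℝ) → (Fin m → ℝ) → ℝ) (z : (Fin n → ℝ) × (Fin m → ℝ)) : ℝ :=
  sSup ((fun y' => f z.1 y') '' Y) - sInf ((fun x' => f x' z.2) '' X)

/-- `z` is an `ε`-solution of `min_{x ∈ X} max_{y ∈ Y} f(x, y)`. -/
def IsEpsSolution {m n : ℕ} (X : Set (Fin n → ℝ)) (Y : Set (Fin m → ℝ))
    (f : (Fin n → ℝ) → (Fin m → ℝ) → ℝ) (ε : ℝ) (z : (Fin n → ℝ) × (Fin m → ℝ)) : Prop :=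
  z.1 ∈ X ∧ z.2 ∈ Y ∧ gap X Y f z ≤ ε

/-- A deterministic algorithm with access to a matrix-vector oracle for an unknown `m × n` real
matrix: it either stops with an output, or queries the oracle at a pair `(x, y)` and continues in
a way determined by the answer.  As usual for oracle complexity, only queries are counted, and the
computation between queries is unrestricted. -/
inductive OracleAlg (m n : ℕ) (α : Type) : Type
  | output (a : α) : OracleAlg m n α
  | query (x : Fin n → ℝ) (y : Fin m → ℝ)
      (next : (Fin m → ℝ) × (Fin n → ℝ) → OracleAlg m n α) : OracleAlg m n α

/-- The answer `(A x, Aᵀ y)` of the matrix-vector oracle for `A` to the query `(x, y)`. -/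
def oracle {m n : ℕ} (A : Matrix (Fin m) (Fin n) ℝ) (x : Fin n → ℝ) (y : Fin m → ℝ) :
    (Fin m → ℝ) × (Fin n → ℝ) :=
  (A *ᵥ x, Aᵀ *ᵥ y)

/-- The output of the algorithm when it is run with the oracle for `A`. -/
def OracleAlg.result {m n : ℕ} {α : Type} (A : Matrix (Fin m) (Fin n) ℝ) :
    OracleAlg m n α → α
  | .output a => a
  | .query x y next => (next (oracle A x y)).result A

/-- The number of queries the algorithm makes when it is run with the oracle for `A`. -/
def OracleAlg.numQueries {m n : ℕ} {α : Type} (A : Matrix (Fin m) (Fin n) ℝ) :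
    OracleAlg m n α → ℕ
  | .output _ => 0
  | .query x y next => (next (oracle A x y)).numQueries A + 1

end MatVecGame

/-!
The game is smoothed. With the rows `a i` of `A` and `μ` of order `ε / log`, the softmax
`F x = μ log ∑ i, exp (⟪a i, x⟫ / μ)` exceeds `max i, ⟪a i, x⟫` by at most `μ log m`, and its
gradient is the average of the rows under the Gibbs weights at `x`, so that it costs two queries
and comes with a mixed strategy of the maximizing player. Averages of such strategies along the
run of a convex optimization method certify its answer. The ball is replaced by the regularizer
`c / 2 ‖x‖ ^ 2`, with `c = 1, 1/2, 1/4, …` down to order `ε`. The first regularized solution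
outside the ball of radius `1/2` can be normalized, and if there is none, then the origin is a
solution (`solves_game`).

A regularized game is solved by an accelerated proximal method of Monteiro and Svaiter type
(`accelerated_step`, `solves_reg_game`). A proximal step is only ever taken over a distance of
order `μ`, within which the Hessian of `F` changes by at most the factor `2`. If the planned
proximal parameter `lam₀` would lead further, a larger parameter `lam` is used and the momentum is
damped by `lam₀ / lam`. The accumulated weight `B` and the planned parameter are tied by
`lam₀ * B ≈ K` with `K = ε ^ (-4/3)`. An undamped step then multiplies `B` by `(1 - θ)⁻¹`, where
`θ = K ^ (-1/2)`, and a damped step decreases the potential, which is bounded by a constant, by a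
multiple of `K * μ ^ 2`. Since `B` has to reach only order `1 / ε`, both kinds of steps are at
most `ε ^ (-2/3)` in number, up to logarithms.

A proximal point is found by following the path of proximal points while the parameter is halved
(`proxGrad_path_step`, `solves_prox`), with gradient steps preconditioned by the shifted Hessian
at the centre (`precond_step`). These converge at a fixed linear rate, but each needs the solution
of a linear system. The Hessian of `F` is positive semidefinite with trace at most `1 / μ`
(`sum_inner_shiftedHess_sub_le`), so all but `k` of its eigenvalues are at most `1 / (k μ)`. A
Krylov space of dimension `k + j` contains a good solution if `j` is a logarithmic multiple of
`√(1 + 1 / (k μ lam))`: the `k` large eigenvalues are annihilated by linear factors, and a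
Chebyshev polynomial takes care of the others (`exists_krylov_residual_le`). As `lam` is at least
of order `K * ε = ε ^ (-1/3)`, the choice `k = ε ^ (-2/9)` makes `j` of the order `ε ^ (-2/9)` as
well. The total is `ε ^ (-2/3) * ε ^ (-2/9) = ε ^ (-8/9)` queries, up to logarithms.

Algorithms are handled through the predicate `Solves N P`, the existence of an oracle algorithm
with at most `N` queries and the postcondition `P`. It has the rules of a program logic, and lets
the postcondition be conditional on facts that the algorithm cannot check.
-/

namespace MatVecGame

open Finset Real
open scoped RealInnerProductSpace

/-! ### Weighted covariance on a finite set -/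

section Covariance

variable {ι : Type*} [Fintype ι]

/-- The mean of `f` under the weights `p`. -/
noncomputable def wmean (p f : ι → ℝ) : ℝ := ∑ i, p i * f i

/-- The covariance of `f` and `g` under the weights `p`. -/
noncomputable def wcov (p f g : ι → ℝ) : ℝ :=
  ∑ i, p i * ((f i - wmean p f) * (g i - wmean p g))

lemma wcov_comm (p f g : ι → ℝ) : wcov p f g = wcov p g f := by
  unfold wcov
  exact Finset.sum_congr rfl fun i _ => by ring

lemma wcov_eq {p : ι → ℝ} (hp : ∑ i, p i = 1) (f g : ι → ℝ) :
    wcov p f g = (∑ i, p i * (f i * g i)) - wmean p f * wmean p g := by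
  have h : ∀ i, p i * ((f i - wmean p f) * (g i - wmean p g)) =
      p i * (f i * g i) - wmean p f * (p i * g i) - wmean p g * (p i * f i)
        + wmean p f * wmean p g * p i := fun i => by ring
  unfold wcov
  simp_rw [h, sum_add_distrib, sum_sub_distrib, ← mul_sum, hp]
  change _ - wmean p f * wmean p g - wmean p g * wmean p f + _ = _
  ring

lemma wcov_self_nonneg {p : ι → ℝ} (hp : ∀ i, 0 ≤ p i) (f : ι → ℝ) : 0 ≤ wcov p f f :=
  sum_nonneg fun i _ => mul_nonneg (hp i) (mul_self_nonneg _)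

lemma wcov_sq_le {p : ι → ℝ} (hp : ∀ i, 0 ≤ p i) (f g : ι → ℝ) :
    wcov p f g ^ 2 ≤ wcov p f f * wcov p g g := by
  have h := sum_mul_sq_le_sq_mul_sq univ (fun i => √(p i) * (f i - wmean p f))
    (fun i => √(p i) * (g i - wmean p g))
  have e : ∀ (u v : ι → ℝ) i, √(p i) * u i * (√(p i) * v i) = p i * (u i * v i) := fun u v i => by
    rw [mul_mul_mul_comm, Real.mul_self_sqrt (hp i)]
  simp only [sq (√_ * _)] at h
  simpa only [wcov, e (fun i => f i - wmean p f) (fun i => g i - wmean p g),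
    e (fun i => f i - wmean p f) (fun i => f i - wmean p f),
    e (fun i => g i - wmean p g) (fun i => g i - wmean p g)] using h

/-- The variance is the least mean squared deviation from a constant. -/
lemma wcov_self_le_sum_sq {p : ι → ℝ} (hp : ∑ i, p i = 1) (f : ι → ℝ) (c : ℝ) :
    wcov p f f ≤ ∑ i, p i * ((f i - c) * (f i - c)) := by
  have h : ∀ i, p i * ((f i - c) * (f i - c)) =
      p i * (f i * f i) - 2 * c * (p i * f i) + c ^ 2 * p i := fun i => by ring
  simp_rw [h, sum_add_distrib, sum_sub_distrib, ← mul_sum, hp]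
  rw [wcov_eq hp]
  change _ ≤ _ - 2 * c * wmean p f + _
  nlinarith [sq_nonneg (wmean p f - c)]

/-- Weights that are dominated by `L p'` have at most `L` times the variance of `p'`. -/
lemma wcov_self_le_of_le {p p' : ι → ℝ} {L : ℝ} (hp : ∑ i, p i = 1)
    (h : ∀ i, p i ≤ L * p' i) (f : ι → ℝ) : wcov p f f ≤ L * wcov p' f f := by
  refine (wcov_self_le_sum_sq hp f (wmean p' f)).trans ?_
  unfold wcov
  rw [mul_sum]
  refine sum_le_sum fun i _ => ?_
  exact (mul_le_mul_of_nonneg_right (h i) (mul_self_nonneg (f i - wmean p' f))).trans_eq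
    (mul_assoc _ _ _)

end Covariance

/-! ### The softmax of finitely many linear forms -/

section Softmax

variable {ι : Type*} [Fintype ι]
variable {E : Type*} [NormedAddCommGroup E] [InnerProductSpace ℝ E]

/-- The partition function `∑ i, exp (⟪a i, x⟫ / μ)`. -/
noncomputable def expSum (a : ι → E) (μ : ℝ) (x : E) : ℝ := ∑ i, exp (⟪a i, x⟫ / μ)

/-- The softmax `μ log ∑ i, exp (⟪a i, x⟫ / μ)`, a smooth approximation of `max i, ⟪a i, x⟫`. -/
noncomputable def softmax (a : ι → E) (μ : ℝ) (x : E) : ℝ := μ * log (expSum a μ x)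

/-- The Gibbs weights `exp (⟪a i, x⟫ / μ) / ∑ j, exp (⟪a j, x⟫ / μ)`. -/
noncomputable def gibbs (a : ι → E) (μ : ℝ) (x : E) (i : ι) : ℝ :=
  exp (⟪a i, x⟫ / μ) / expSum a μ x

/-- The gradient of the softmax: the mean of the vectors `a i` under the Gibbs weights. -/
noncomputable def smGrad (a : ι → E) (μ : ℝ) (x : E) : E := ∑ i, gibbs a μ x i • a i

variable {a : ι → E} {μ : ℝ}

lemma inner_smGrad (x w : E) :
    ⟪smGrad a μ x, w⟫ = wmean (gibbs a μ x) fun i => ⟪a i, w⟫ := by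
  simp [smGrad, wmean, sum_inner, inner_smul_left]

lemma softmax_zero : softmax a μ 0 = μ * log (Fintype.card ι) := by
  simp [softmax, expSum]

variable [Nonempty ι]

lemma expSum_pos (x : E) : 0 < expSum a μ x :=
  sum_pos (fun _ _ => exp_pos _) univ_nonempty

lemma gibbs_pos (x : E) (i : ι) : 0 < gibbs a μ x i := div_pos (exp_pos _) (expSum_pos x)

lemma gibbs_nonneg (x : E) (i : ι) : 0 ≤ gibbs a μ x i := (gibbs_pos x i).le

lemma sum_gibbs (x : E) : ∑ i, gibbs a μ x i = 1 := by
  unfold gibbs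
  rw [← sum_div]
  exact div_self (expSum_pos x).ne'

lemma norm_smGrad_le (ha : ∀ i, ‖a i‖ ≤ 1) (x : E) : ‖smGrad a μ x‖ ≤ 1 := by
  refine (norm_sum_le _ _).trans ?_
  rw [← sum_gibbs (a := a) (μ := μ) x]
  refine sum_le_sum fun i _ => ?_
  rw [norm_smul, Real.norm_of_nonneg (gibbs_nonneg x i)]
  exact mul_le_of_le_one_right (gibbs_nonneg x i) (ha i)

lemma inner_le_softmax (hμ : 0 < μ) (x : E) (i : ι) : ⟪a i, x⟫ ≤ softmax a μ x := by
  have h : exp (⟪a i, x⟫ / μ) ≤ expSum a μ x :=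
    single_le_sum (f := fun i => exp (⟪a i, x⟫ / μ)) (fun _ _ => (exp_pos _).le) (mem_univ i)
  have := (Real.le_log_iff_exp_le (expSum_pos x)).2 h
  rw [div_le_iff₀ hμ] at this
  rw [softmax, mul_comm]
  exact this

/-- The softmax lies above its tangents. -/
lemma softmax_add_inner_le (hμ : 0 < μ) (x z : E) :
    softmax a μ z + ⟪smGrad a μ z, x - z⟫ ≤ softmax a μ x := by
  -- Jensen: `∑ p t ≤ log ∑ p exp t` for the Gibbs weights `p` at `z`
  have hsum : expSum a μ x / expSum a μ z = ∑ i, gibbs a μ z i * exp (⟪a i, x - z⟫ / μ) := by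
    rw [expSum, sum_div]
    refine sum_congr rfl fun i _ => ?_
    rw [gibbs, inner_sub_right, sub_div, exp_sub]
    field_simp
  have hJ := convexOn_exp.map_sum_le (t := univ) (w := gibbs a μ z)
    (p := fun i => ⟪a i, x - z⟫ / μ) (fun i _ => gibbs_nonneg z i) (sum_gibbs z)
    (fun i _ => Set.mem_univ _)
  simp only [smul_eq_mul] at hJ
  rw [← hsum] at hJ
  have h1 := (Real.le_log_iff_exp_le (div_pos (expSum_pos x) (expSum_pos z))).2 hJ
  rw [Real.log_div (expSum_pos x).ne' (expSum_pos z).ne'] at h1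
  have h2 : ∑ i, gibbs a μ z i * (⟪a i, x - z⟫ / μ) = ⟪smGrad a μ z, x - z⟫ / μ := by
    rw [inner_smGrad, wmean, sum_div]
    exact sum_congr rfl fun i _ => by ring
  rw [h2, div_le_iff₀ hμ] at h1
  unfold softmax
  linarith

/-- Up to the entropy, which is at most `log (card ι)`, the tangent of the softmax at `x` is the
linear form given by the Gibbs weights at `x`. -/
lemma softmax_add_inner_le_entropy (hμ : 0 < μ) (x u : E) :
    softmax a μ x + ⟪smGrad a μ x, u - x⟫ ≤
      ⟪smGrad a μ x, u⟫ + μ * log (Fintype.card ι) := by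
  have h := softmax_add_inner_le (a := a) hμ 0 x
  rw [softmax_zero] at h
  rw [inner_sub_right] at h ⊢
  simp only [inner_zero_right] at h
  linarith

/-- The Gibbs weights are multiplicatively stable, uniformly over the vectors `a i` of norm at most
`1`. This is what makes the Hessian of the softmax stable in balls whose radius is of order `μ`. -/
lemma gibbs_le_of_norm_sub_le (hμ : 0 < μ) (ha : ∀ i, ‖a i‖ ≤ 1) {x q : E} {r : ℝ}
    (h : ‖x - q‖ ≤ r) (i : ι) : gibbs a μ x i ≤ exp (2 * r / μ) * gibbs a μ q i := by
  have hin : ∀ i, |⟪a i, x⟫ - ⟪a i, q⟫| ≤ r := fun i => by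
    rw [← inner_sub_right]
    calc _ ≤ ‖a i‖ * ‖x - q‖ := abs_real_inner_le_norm _ _
      _ ≤ 1 * ‖x - q‖ := by gcongr; exact ha i
      _ ≤ r := by linarith
  have h1 : ∀ i, exp (⟪a i, x⟫ / μ) ≤ exp (r / μ) * exp (⟪a i, q⟫ / μ) := fun i => by
    rw [← exp_add, ← add_div]
    gcongr
    linarith [abs_le.1 (hin i)]
  have h2 : expSum a μ q ≤ exp (r / μ) * expSum a μ x := by
    unfold expSum
    rw [mul_sum]
    refine sum_le_sum fun i _ => ?_
    rw [← exp_add, ← add_div]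
    gcongr
    linarith [abs_le.1 (hin i)]
  unfold gibbs
  rw [div_le_iff₀ (expSum_pos x), mul_assoc, div_mul_eq_mul_div, ← mul_div_assoc,
    le_div_iff₀ (expSum_pos q)]
  calc exp (⟪a i, x⟫ / μ) * expSum a μ q
      ≤ (exp (r / μ) * exp (⟪a i, q⟫ / μ)) * (exp (r / μ) * expSum a μ x) := by
        gcongr
        · exact (expSum_pos q).le
        · exact h1 i
    _ = _ := by
        rw [mul_mul_mul_comm, ← exp_add, ← mul_assoc]
        ring_nf

lemma hasDerivAt_inner_smGrad (x d w : E) (s : ℝ) :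
    HasDerivAt (fun s : ℝ => ⟪smGrad a μ (x + s • d), w⟫)
      (wcov (gibbs a μ (x + s • d)) (fun i => ⟪a i, w⟫) (fun i => ⟪a i, d⟫) / μ) s := by
  have he : ∀ i, HasDerivAt (fun s : ℝ => exp (⟪a i, x + s • d⟫ / μ))
      (exp (⟪a i, x + s • d⟫ / μ) * (⟪a i, d⟫ / μ)) s := fun i => by
    have h0 : (fun s : ℝ => ⟪a i, x + s • d⟫ / μ) = fun s : ℝ => (⟪a i, x⟫ + s * ⟪a i, d⟫) / μ := by
      funext s; rw [inner_add_right, inner_smul_right]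
    have h1 : HasDerivAt (fun s : ℝ => ⟪a i, x + s • d⟫ / μ) (⟪a i, d⟫ / μ) s := by
      rw [h0]
      simpa using (((hasDerivAt_id s).mul_const (⟪a i, d⟫)).const_add (⟪a i, x⟫)).div_const μ
    exact h1.exp
  have hS : HasDerivAt (fun s : ℝ => expSum a μ (x + s • d))
      (∑ i, exp (⟪a i, x + s • d⟫ / μ) * (⟪a i, d⟫ / μ)) s := by
    unfold expSum
    exact HasDerivAt.fun_sum fun i _ => he i
  have hN : HasDerivAt (fun s : ℝ => ∑ i, exp (⟪a i, x + s • d⟫ / μ) * ⟪a i, w⟫)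
      (∑ i, exp (⟪a i, x + s • d⟫ / μ) * (⟪a i, d⟫ / μ) * ⟪a i, w⟫) s :=
    HasDerivAt.fun_sum fun i _ => (he i).mul_const _
  have hq := hN.div hS (expSum_pos _).ne'
  have hf : (fun s : ℝ => ⟪smGrad a μ (x + s • d), w⟫) = fun s =>
      (∑ i, exp (⟪a i, x + s • d⟫ / μ) * ⟪a i, w⟫) / expSum a μ (x + s • d) := by
    funext s
    rw [inner_smGrad, wmean, sum_div]
    exact sum_congr rfl fun i _ => by rw [gibbs]; ring
  rw [hf]
  refine hq.congr_deriv ?_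
  symm
  have hpos := expSum_pos (a := a) (μ := μ) (x + s • d)
  rw [wcov_eq (sum_gibbs _)]
  set S := expSum a μ (x + s • d) with hSdef
  have e1 : ∑ i, gibbs a μ (x + s • d) i * (⟪a i, w⟫ * ⟪a i, d⟫) =
      (∑ i, exp (⟪a i, x + s • d⟫ / μ) * (⟪a i, w⟫ * ⟪a i, d⟫)) / S := by
    rw [sum_div]; exact sum_congr rfl fun i _ => by rw [gibbs]; ring
  have e2 : ∀ w, wmean (gibbs a μ (x + s • d)) (fun i => ⟪a i, w⟫) =
      (∑ i, exp (⟪a i, x + s • d⟫ / μ) * ⟪a i, w⟫) / S := fun w => by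
    rw [wmean, sum_div]; exact sum_congr rfl fun i _ => by rw [gibbs]; ring
  have e3 : ∑ i, exp (⟪a i, x + s • d⟫ / μ) * (⟪a i, d⟫ / μ) * ⟪a i, w⟫ =
      (∑ i, exp (⟪a i, x + s • d⟫ / μ) * (⟪a i, w⟫ * ⟪a i, d⟫)) / μ := by
    rw [sum_div]; exact sum_congr rfl fun i _ => by ring
  have e4 : ∑ i, exp (⟪a i, x + s • d⟫ / μ) * (⟪a i, d⟫ / μ) =
      (∑ i, exp (⟪a i, x + s • d⟫ / μ) * ⟪a i, d⟫) / μ := by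
    rw [sum_div]; exact sum_congr rfl fun i _ => by ring
  rw [e1, e2, e2, e3, e4]
  field_simp

/-- The Hessian form of the softmax at `q`: the covariance, divided by `μ`, of two linear forms
under the Gibbs weights at `q`. -/
noncomputable def hessForm (a : ι → E) (μ : ℝ) (q w w' : E) : ℝ :=
  wcov (gibbs a μ q) (fun i => ⟪a i, w⟫) (fun i => ⟪a i, w'⟫) / μ

lemma hessForm_self_nonneg (hμ : 0 < μ) (q w : E) : 0 ≤ hessForm a μ q w w :=
  div_nonneg (wcov_self_nonneg (gibbs_nonneg q) _) hμ.le

lemma exists_inner_smGrad_sub_eq (x z w : E) :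
    ∃ s ∈ Set.Ioo (0 : ℝ) 1,
      ⟪smGrad a μ x - smGrad a μ z, w⟫ = hessForm a μ (z + s • (x - z)) w (x - z) := by
  obtain ⟨s, hs, h⟩ := exists_hasDerivAt_eq_slope
    (fun s : ℝ => ⟪smGrad a μ (z + s • (x - z)), w⟫) _ (zero_lt_one' ℝ)
    (fun s _ => (hasDerivAt_inner_smGrad z (x - z) w s).continuousAt.continuousWithinAt)
    (fun s _ => hasDerivAt_inner_smGrad z (x - z) w s)
  refine ⟨s, hs, ?_⟩
  rw [hessForm, h]
  simp [inner_sub_left]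

lemma exp_two_thirds_le_two : exp (2 / 3) ≤ 2 := by
  rw [← Real.le_log_iff_exp_le (by norm_num)]
  linarith [Real.log_two_gt_d9]

section Stability

variable {q x z : E}

lemma gibbs_le_two_mul (hμ : 0 < μ) (ha : ∀ i, ‖a i‖ ≤ 1)
    (hx : ‖x - q‖ ≤ μ / 3) (i : ι) : gibbs a μ x i ≤ 2 * gibbs a μ q i := by
  refine (gibbs_le_of_norm_sub_le hμ ha hx i).trans ?_
  refine mul_le_mul_of_nonneg_right ?_ (gibbs_nonneg q i)
  have h : 2 * (μ / 3) / μ = 2 / 3 := by field_simp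
  rw [h]
  exact exp_two_thirds_le_two

lemma hessForm_self_le_two_mul (hμ : 0 < μ) (ha : ∀ i, ‖a i‖ ≤ 1)
    (hx : ‖x - q‖ ≤ μ / 3) (w : E) :
    hessForm a μ x w w ≤ 2 * hessForm a μ q w w := by
  unfold hessForm
  rw [← mul_div_assoc]
  gcongr
  exact wcov_self_le_of_le (sum_gibbs x) (gibbs_le_two_mul hμ ha hx) _

/-- Near `q` the gradient of the softmax is Lipschitz in the seminorm of the Hessian at `q`. -/
lemma inner_smGrad_sub_sq_le (hμ : 0 < μ) (ha : ∀ i, ‖a i‖ ≤ 1)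
    (hx : ‖x - q‖ ≤ μ / 3) (hz : ‖z - q‖ ≤ μ / 3) (w : E) :
    ⟪smGrad a μ x - smGrad a μ z, w⟫ ^ 2 ≤
      4 * hessForm a μ q (x - z) (x - z) * hessForm a μ q w w := by
  obtain ⟨s, hs, h⟩ := exists_inner_smGrad_sub_eq (a := a) (μ := μ) x z w
  have hy : ‖z + s • (x - z) - q‖ ≤ μ / 3 := by
    have := (convex_closedBall q (μ / 3)).add_smul_sub_mem (x := z) (y := x)
      (by simpa [dist_eq_norm] using hz) (by simpa [dist_eq_norm] using hx) ⟨hs.1.le, hs.2.le⟩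
    simpa [dist_eq_norm] using this
  rw [h]
  set y := z + s • (x - z)
  have h1 : hessForm a μ y w (x - z) ^ 2 ≤
      hessForm a μ y w w * hessForm a μ y (x - z) (x - z) := by
    unfold hessForm
    rw [div_pow, div_mul_div_comm, sq μ]
    gcongr
    exact wcov_sq_le (gibbs_nonneg y) _ _
  have h2 := hessForm_self_le_two_mul hμ ha hy w
  have h3 := hessForm_self_le_two_mul hμ ha hy (x - z)
  have h4 := mul_le_mul h2 h3 (hessForm_self_nonneg hμ y _)
    (by linarith [hessForm_self_nonneg (a := a) hμ q w])
  linarith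

lemma half_hessForm_le_inner_smGrad_sub (hμ : 0 < μ) (ha : ∀ i, ‖a i‖ ≤ 1)
    (hx : ‖x - q‖ ≤ μ / 3) (hz : ‖z - q‖ ≤ μ / 3) :
    hessForm a μ q (x - z) (x - z) / 2 ≤ ⟪smGrad a μ x - smGrad a μ z, x - z⟫ := by
  obtain ⟨s, hs, h⟩ := exists_inner_smGrad_sub_eq (a := a) (μ := μ) x z (x - z)
  have hy : ‖z + s • (x - z) - q‖ ≤ μ / 3 := by
    have := (convex_closedBall q (μ / 3)).add_smul_sub_mem (x := z) (y := x)
      (by simpa [dist_eq_norm] using hz) (by simpa [dist_eq_norm] using hx) ⟨hs.1.le, hs.2.le⟩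
    simpa [dist_eq_norm] using this
  have := hessForm_self_le_two_mul hμ ha (x := q) (q := z + s • (x - z))
    (by rwa [norm_sub_rev]) (x - z)
  linarith

end Stability

lemma inner_smGrad_sub_nonneg (hμ : 0 < μ) (x z : E) :
    0 ≤ ⟪smGrad a μ x - smGrad a μ z, x - z⟫ := by
  have h1 := softmax_add_inner_le (a := a) hμ x z
  have h2 := softmax_add_inner_le (a := a) hμ z x
  rw [inner_sub_left]
  rw [← neg_sub x z, inner_neg_right] at h2
  linarith

end Softmax

/-! ### Polynomials of small degree that are small on a spectrum -/

section Polynomials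

open Polynomial

/-- A rescaled Chebyshev polynomial: it has the value `1` at `0` and decays on `[σ, σ + w]` at a
rate governed by the square root of the condition number `1 + w / σ`. -/
lemma exists_chebyshev_small {σ w : ℝ} (hσ : 0 < σ) (hw : 0 < w) (j : ℕ) :
    ∃ Q : ℝ[X], Q.natDegree ≤ j ∧ Q.eval 0 = 1 ∧
      ∀ s, σ ≤ s → s ≤ σ + w → |Q.eval s| ≤ 2 * exp (-(j / √(1 + w / σ))) := by
  set κ := 1 + w / σ with hκ
  have hκ1 : 1 < κ := by have := div_pos hw hσ; linarith
  set y := (2 * σ + w) / w with hy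
  have hy1 : 1 ≤ y := by rw [hy, le_div_iff₀ hw]; linarith
  have hcosh : cosh (1 / √κ) ≤ y := by
    refine (cosh_le_exp_half_sq _).trans ?_
    rw [div_pow, one_pow, Real.sq_sqrt (by linarith)]
    have hu : 0 < 1 / κ := by positivity
    have hu1 : 1 / κ < 1 := by rw [div_lt_one (by linarith)]; exact hκ1
    have h1 := Real.one_sub_le_exp_neg (1 / κ / 2)
    rw [exp_neg] at h1
    have h2 : exp (1 / κ / 2) ≤ (1 - 1 / κ / 2)⁻¹ := by
      rw [le_inv_comm₀ (exp_pos _) (by linarith)]; exact h1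
    refine h2.trans ?_
    have e : 1 / κ = σ / (σ + w) := by rw [hκ]; field_simp
    rw [e, hy, inv_le_comm₀ (by rw [e] at hu1; linarith) (by positivity), inv_div, ← sub_nonneg]
    have : 1 - σ / (σ + w) / 2 - w / (2 * σ + w) =
        (2 * σ ^ 2 + 3 * (σ * w)) / (2 * (σ + w) * (2 * σ + w)) := by
      field_simp; ring
    rw [this]
    positivity
  have hTy : exp (j / √κ) / 2 ≤ (Chebyshev.T ℝ (j : ℤ)).eval y := by
    rw [← cosh_arcosh hy1, Chebyshev.T_real_cosh]
    have ht : 1 / √κ ≤ arcosh y := by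
      rw [← arcosh_cosh (x := 1 / √κ) (by positivity)]
      exact (arcosh_le_arcosh (by positivity) (by linarith)).2 hcosh
    have h3 : exp (j / √κ) ≤ exp (((j : ℤ) : ℝ) * arcosh y) := by
      apply exp_le_exp.2
      rw [div_eq_mul_one_div]
      push_cast
      gcongr
    rw [cosh_eq]
    linarith [exp_pos (-(((j : ℤ) : ℝ) * arcosh y))]
  have hTpos : 0 < (Chebyshev.T ℝ (j : ℤ)).eval y := lt_of_lt_of_le (by positivity) hTy
  refine ⟨C ((Chebyshev.T ℝ (j : ℤ)).eval y)⁻¹ *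
    (Chebyshev.T ℝ (j : ℤ)).comp (C y - C (2 / w) * X), ?_, ?_, ?_⟩
  · refine (natDegree_C_mul_le _ _).trans (natDegree_comp_le.trans ?_)
    rw [Chebyshev.natDegree_T]
    have : (C y - C (2 / w) * X : ℝ[X]).natDegree ≤ 1 := by compute_degree
    simpa using Nat.mul_le_mul_left j this
  · simp [inv_mul_cancel₀ hTpos.ne']
  · intro s h1 h2
    have harg : |y - 2 / w * s| ≤ 1 := by
      have : y - 2 / w * s = (2 * σ + w - 2 * s) / w := by rw [hy]; field_simp
      rw [this, abs_le, le_div_iff₀ hw, div_le_iff₀ hw]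
      constructor <;> linarith
    have hT1 := Chebyshev.abs_eval_T_real_le_one j harg
    simp only [eval_mul, eval_C, eval_comp, eval_sub, eval_X, abs_mul, abs_inv]
    rw [abs_of_pos hTpos, exp_neg, inv_mul_le_iff₀ hTpos]
    refine hT1.trans ?_
    calc (1 : ℝ) = exp (j / √κ) / 2 * (2 * (exp (j / √κ))⁻¹) := by field_simp
      _ ≤ _ := by gcongr

/-- If all but few of finitely many numbers `s i ≥ σ` are close to `σ`, then a polynomial with
constant term `1` and small degree is small at all of them: the factors `1 - X / s i` annihilate
the at most `k` numbers above `σ + τ / k`, and a Chebyshev polynomial takes care of the others. -/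
lemma exists_polynomial_small {N : ℕ} (s : Fin N → ℝ) {σ τ : ℝ} (hσ : 0 < σ) (hτ : 0 < τ)
    (hs : ∀ i, σ ≤ s i) (hsum : ∑ i, (s i - σ) ≤ τ) {k : ℕ} (hk : 0 < k) (j : ℕ) :
    ∃ R : ℝ[X], R.natDegree ≤ k + j ∧ R.eval 0 = 1 ∧
      ∀ i, |R.eval (s i)| ≤ 2 * exp (-(j / √(1 + τ / (k * σ)))) := by
  have hk' : (0 : ℝ) < k := by exact_mod_cast hk
  have hw : 0 < τ / k := div_pos hτ hk'
  obtain ⟨Q, hQd, hQ0, hQ⟩ := exists_chebyshev_small hσ hw j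
  rw [div_div] at hQ
  set big := univ.filter fun i => σ + τ / k < s i with hbig
  have hcard : #big ≤ k := by
    have h1 : (#big : ℝ) * (τ / k) ≤ ∑ i ∈ big, (s i - σ) := by
      rw [← nsmul_eq_mul]
      refine card_nsmul_le_sum _ _ _ fun i hi => ?_
      have := (mem_filter.1 hi).2
      linarith
    have h2 : ∑ i ∈ big, (s i - σ) ≤ ∑ i, (s i - σ) :=
      sum_le_univ_sum_of_nonneg fun i => by linarith [hs i]
    have h3 : (#big : ℝ) * (τ / k) ≤ k * (τ / k) := by
      rw [mul_div_cancel₀ τ hk'.ne']; linarith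
    exact_mod_cast le_of_mul_le_mul_right h3 hw
  refine ⟨(∏ i ∈ big, (1 - C (s i)⁻¹ * X)) * Q, ?_, ?_, ?_⟩
  · refine natDegree_mul_le.trans (add_le_add ((natDegree_prod_le _ _).trans ?_) hQd)
    refine (sum_le_card_nsmul _ _ 1 fun i _ => ?_).trans (by simpa using hcard)
    compute_degree
  · simp [eval_prod, hQ0]
  · intro m
    rw [eval_mul, eval_prod, abs_mul, abs_prod]
    by_cases hm : σ + τ / k < s m
    · have h0 : ∏ i ∈ big, |eval (s m) (1 - C (s i)⁻¹ * X : ℝ[X])| = 0 := by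
        refine prod_eq_zero (i := m) (by simp [hbig, hm]) ?_
        have : s m ≠ 0 := by linarith [hs m]
        simp [inv_mul_cancel₀ this]
      rw [h0, zero_mul]
      positivity
    · have h1 : ∏ i ∈ big, |eval (s m) (1 - C (s i)⁻¹ * X : ℝ[X])| ≤ 1 := by
        refine prod_le_one (fun _ _ => abs_nonneg _) fun i hi => ?_
        have hi' := (mem_filter.1 hi).2
        have hsi : 0 < s i := lt_of_lt_of_le hσ (hs i)
        have hle : (s i)⁻¹ * s m ≤ 1 := by
          rw [inv_mul_le_iff₀ hsi]; linarith
        have hge : 0 ≤ (s i)⁻¹ * s m :=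
          mul_nonneg (inv_nonneg.2 hsi.le) (by linarith [hs m])
        simp only [eval_sub, eval_one, eval_mul, eval_C, eval_X]
        rw [abs_le]
        constructor <;> linarith
      calc _ ≤ 1 * |Q.eval (s m)| := by gcongr
        _ ≤ _ := by rw [one_mul]; exact hQ _ (hs m) (not_lt.1 hm)

end Polynomials

/-! ### Krylov subspaces -/

section Krylov

open Polynomial

variable {E : Type*} [NormedAddCommGroup E] [InnerProductSpace ℝ E] [FiniteDimensional ℝ E]

lemma norm_aeval_apply_le {M : E →ₗ[ℝ] E} (hM : M.IsSymmetric) {N : ℕ}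
    (hN : Module.finrank ℝ E = N) {R : ℝ[X]} {δ : ℝ} (hδ : 0 ≤ δ)
    (hR : ∀ i, |R.eval (hM.eigenvalues hN i)| ≤ δ) (g : E) : ‖aeval M R g‖ ≤ δ * ‖g‖ := by
  set b := hM.eigenvectorBasis hN
  have hb : ∀ i, aeval M R (b i) = R.eval (hM.eigenvalues hN i) • b i := fun i =>
    Module.End.aeval_apply_of_hasEigenvector (hM.hasEigenvector_eigenvectorBasis hN i)
  have hg : aeval M R g = ∑ i, (R.eval (hM.eigenvalues hN i) * ⟪b i, g⟫) • b i := by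
    conv_lhs => rw [← b.sum_repr' g]
    rw [map_sum]
    refine sum_congr rfl fun i _ => ?_
    rw [map_smul, hb, smul_smul, mul_comm]
  have hin : ∀ i, ⟪b i, aeval M R g⟫ = R.eval (hM.eigenvalues hN i) * ⟪b i, g⟫ := fun i => by
    rw [hg, b.orthonormal.inner_right_fintype]
  have h1 : ‖aeval M R g‖ ^ 2 ≤ (δ * ‖g‖) ^ 2 := by
    rw [mul_pow, ← b.sum_sq_norm_inner_right (aeval M R g), ← b.sum_sq_norm_inner_right g, mul_sum]
    refine sum_le_sum fun i _ => ?_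
    rw [hin, norm_mul, mul_pow]
    gcongr
    exact hR i
  exact le_of_sq_le_sq h1 (by positivity)

/-- A linear system whose operator is `σ` plus a nonnegative operator of trace at most `τ` can be
solved with relative residual `δ` in the Krylov space of dimension `k + j`, where the `k` largest
eigenvalues cost one dimension each, and the others have condition number `1 + τ / (k σ)`. -/
lemma exists_krylov_residual_le {M : E →ₗ[ℝ] E} (hM : M.IsSymmetric) {σ τ δ : ℝ} (hσ : 0 < σ)
    (hτ : 0 < τ) (hMσ : ∀ w, σ * ‖w‖ ^ 2 ≤ ⟪M w, w⟫)
    (htr : ∀ b : OrthonormalBasis (Fin (Module.finrank ℝ E)) ℝ E, ∑ i, (⟪M (b i), b i⟫ - σ) ≤ τ)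
    {k : ℕ} (hk : 0 < k) {j : ℕ} (hδ : 2 * exp (-(j / √(1 + τ / (k * σ)))) ≤ δ) (g : E) :
    ∃ c : ℕ → ℝ, ‖∑ i ∈ range (k + j), c i • (M ^ (i + 1)) g - g‖ ≤ δ * ‖g‖ := by
  set b := hM.eigenvectorBasis rfl
  set s := hM.eigenvalues rfl
  have hs : ∀ i, ⟪M (b i), b i⟫ = s i := fun i => by
    rw [hM.apply_eigenvectorBasis rfl i, inner_smul_left, real_inner_self_eq_norm_sq,
      b.norm_eq_one]
    simp [s]
  have hsσ : ∀ i, σ ≤ s i := fun i => by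
    have := hMσ (b i)
    rw [hs, b.norm_eq_one] at this
    linarith
  have hsum : ∑ i, (s i - σ) ≤ τ := by
    have := htr b
    simpa only [hs] using this
  obtain ⟨R, hRd, hR0, hR⟩ := exists_polynomial_small s hσ hτ hsσ hsum hk j
  have hδ0 : 0 ≤ δ := le_trans (by positivity) hδ
  have hle := norm_aeval_apply_le hM rfl hδ0 (fun i => (hR i).trans hδ) g
  refine ⟨fun i => -R.coeff (i + 1), ?_⟩
  have h0 : R.coeff 0 = 1 := by rw [coeff_zero_eq_eval_zero, hR0]
  have he : ∑ i ∈ range (k + j), -R.coeff (i + 1) • (M ^ (i + 1)) g - g = -aeval M R g := by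
    rw [aeval_eq_sum_range' (n := k + j + 1) (by omega), sum_range_succ', LinearMap.add_apply,
      LinearMap.sum_apply, h0, neg_add, ← sum_neg_distrib, sub_eq_add_neg]
    simp
  rw [he, norm_neg]
  exact hle

end Krylov

/-! ### Preconditioned gradient steps -/

section Precond

variable {E : Type*} [NormedAddCommGroup E] [InnerProductSpace ℝ E]

lemma norm_sq_le_of_inner_sq_le {M : E →ₗ[ℝ] E} {Λ : ℝ} (hΛ : 0 ≤ Λ)
    (hMΛ : ∀ w, ⟪M w, w⟫ ≤ Λ * ‖w‖ ^ 2)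
    {g : E} {m : ℝ} (hm : 0 ≤ m) (hg : ∀ u, ⟪g, u⟫ ^ 2 ≤ 4 * m * ⟪M u, u⟫) :
    ‖g‖ ^ 2 ≤ 4 * m * Λ := by
  have h1 := hg g
  rw [real_inner_self_eq_norm_sq] at h1
  rcases eq_or_ne g 0 with rfl | h0
  · rw [norm_zero, zero_pow two_ne_zero]
    positivity
  · have hpos : 0 < ‖g‖ ^ 2 := by positivity
    have h2 : ‖g‖ ^ 2 * ‖g‖ ^ 2 ≤ (4 * m * Λ) * ‖g‖ ^ 2 := by
      have := mul_le_mul_of_nonneg_left (hMΛ g) (by positivity : 0 ≤ 4 * m)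
      nlinarith
    exact le_of_mul_le_mul_right h2 hpos

lemma inner_sq_le_norm_sq_mul (u v : E) : ⟪u, v⟫ ^ 2 ≤ ‖u‖ ^ 2 * ‖v‖ ^ 2 := by
  rw [← mul_pow, ← sq_abs]
  gcongr
  exact abs_real_inner_le_norm u v

/-- One step of gradient descent preconditioned by `M` contracts the error `e` in the norm of `M`,
if the gradient `g` is comparable to `M e`, and if the linear system for the step `w` is solved up
to a small relative residual. -/
lemma precond_step {M : E →ₗ[ℝ] E} (hM : M.IsSymmetric) {σ Λ δ : ℝ} (hσ : 0 < σ) (hΛ : 0 ≤ Λ)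
    (hMσ : ∀ w, σ * ‖w‖ ^ 2 ≤ ⟪M w, w⟫) (hMΛ : ∀ w, ⟪M w, w⟫ ≤ Λ * ‖w‖ ^ 2)
    (hδ : 1024 * δ ^ 2 * Λ ≤ σ) {e g w : E}
    (hg : ∀ u, ⟪g, u⟫ ^ 2 ≤ 4 * ⟪M e, e⟫ * ⟪M u, u⟫) (hge : ⟪M e, e⟫ / 2 ≤ ⟪g, e⟫)
    (hw : ‖M w - g‖ ≤ δ * ‖g‖) :
    ⟪M (e - (1 / 32 : ℝ) • w), e - (1 / 32 : ℝ) • w⟫ ≤ 63 / 64 * ⟪M e, e⟫ := by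
  set ρ := M w - g with hρ
  set me := ⟪M e, e⟫ with hme
  set mw := ⟪M w, w⟫ with hmw
  have hme0 : 0 ≤ me := le_trans (by positivity) (hMσ e)
  have hmw0 : 0 ≤ mw := le_trans (by positivity) (hMσ w)
  have hg2 : ‖g‖ ^ 2 ≤ 4 * me * Λ := norm_sq_le_of_inner_sq_le hΛ hMΛ hme0 hg
  have hρ2 : ‖ρ‖ ^ 2 ≤ σ * me / 256 := by
    have h1 : ‖ρ‖ ^ 2 ≤ (δ * ‖g‖) ^ 2 := by gcongr
    have h2 : δ ^ 2 * ‖g‖ ^ 2 ≤ δ ^ 2 * (4 * me * Λ) := by gcongr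
    have h3 : (1024 * δ ^ 2 * Λ) * me ≤ σ * me := by gcongr
    nlinarith
  have hsmall : ∀ u : E, ⟪ρ, u⟫ ^ 2 ≤ me * ⟪M u, u⟫ / 256 := fun u => by
    refine (inner_sq_le_norm_sq_mul ρ u).trans ?_
    calc ‖ρ‖ ^ 2 * ‖u‖ ^ 2 ≤ σ * me / 256 * ‖u‖ ^ 2 := by gcongr
      _ = me * (σ * ‖u‖ ^ 2) / 256 := by ring
      _ ≤ _ := by gcongr; exact hMσ u
  have hρe : -(me / 16) ≤ ⟪ρ, e⟫ :=
    (abs_le_of_sq_le_sq' (by have := hsmall e; nlinarith) (by positivity)).1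
  have hMw : M w = g + ρ := by rw [hρ]; abel
  have hmw_eq : mw = ⟪g, w⟫ + ⟪ρ, w⟫ := by rw [hmw, hMw, inner_add_left]
  have hmw9 : mw ≤ 9 * me := by
    have h1 := hg w
    have h2 := hsmall w
    have h3 : mw * mw ≤ 9 * me * mw := by
      have : mw ^ 2 ≤ 2 * ⟪g, w⟫ ^ 2 + 2 * ⟪ρ, w⟫ ^ 2 := by
        rw [hmw_eq]; nlinarith [sq_nonneg (⟪g, w⟫ - ⟪ρ, w⟫)]
      nlinarith [mul_nonneg hme0 hmw0]
    rcases hmw0.eq_or_lt with h0 | h0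
    · rw [← h0]; positivity
    · exact le_of_mul_le_mul_right h3 h0
  have hexp : ⟪M (e - (1 / 32 : ℝ) • w), e - (1 / 32 : ℝ) • w⟫ =
      me - 1 / 16 * (⟪g, e⟫ + ⟪ρ, e⟫) + 1 / 1024 * mw := by
    have hsym : ⟪M e, w⟫ = ⟪g, e⟫ + ⟪ρ, e⟫ := by
      rw [hM e w, real_inner_comm, hMw, inner_add_left]
    have hwe : ⟪M w, e⟫ = ⟪g, e⟫ + ⟪ρ, e⟫ := by rw [hMw, inner_add_left]
    simp only [map_sub, map_smul, inner_sub_left, inner_sub_right, inner_smul_left,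
      inner_smul_right, hsym, hwe]
    simp only [conj_trivial]
    ring
  rw [hexp]
  linarith

end Precond

/-! ### The Hessian of the softmax as an operator -/

section Hessian

variable {ι : Type*} [Fintype ι]
variable {E : Type*} [NormedAddCommGroup E] [InnerProductSpace ℝ E]

/-- The Hessian of the softmax at `q`, shifted by `σ`. -/
noncomputable def shiftedHess (a : ι → E) (μ : ℝ) (q : E) (σ : ℝ) : E →ₗ[ℝ] E where
  toFun w := ∑ i, (gibbs a μ q i * (⟪a i, w⟫ - ⟪smGrad a μ q, w⟫) / μ) • a i + σ • w
  map_add' w w' := by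
    have h : ∀ i, gibbs a μ q i * (⟪a i, w + w'⟫ - ⟪smGrad a μ q, w + w'⟫) / μ =
        gibbs a μ q i * (⟪a i, w⟫ - ⟪smGrad a μ q, w⟫) / μ +
          gibbs a μ q i * (⟪a i, w'⟫ - ⟪smGrad a μ q, w'⟫) / μ := fun i => by
      rw [inner_add_right, inner_add_right]; ring
    simp_rw [h, add_smul, sum_add_distrib, smul_add]
    abel
  map_smul' t w := by
    have h : ∀ i, gibbs a μ q i * (⟪a i, t • w⟫ - ⟪smGrad a μ q, t • w⟫) / μ =
        t * (gibbs a μ q i * (⟪a i, w⟫ - ⟪smGrad a μ q, w⟫) / μ) := fun i => by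
      rw [inner_smul_right, inner_smul_right]; ring
    simp_rw [h, mul_smul, ← smul_sum]
    rw [RingHom.id_apply, smul_add, smul_comm σ t w]

lemma shiftedHess_apply (a : ι → E) (μ : ℝ) (q : E) (σ : ℝ) (w : E) :
    shiftedHess a μ q σ w =
      ∑ i, (gibbs a μ q i * (⟪a i, w⟫ - ⟪smGrad a μ q, w⟫) / μ) • a i + σ • w := rfl

variable [Nonempty ι] {a : ι → E} {μ : ℝ}

lemma inner_shiftedHess (q w w' : E) (σ : ℝ) :
    ⟪shiftedHess a μ q σ w, w'⟫ = hessForm a μ q w w' + σ * ⟪w, w'⟫ := by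
  rw [shiftedHess_apply, inner_add_left, inner_smul_left, sum_inner, hessForm,
    wcov_eq (sum_gibbs q)]
  simp only [inner_smul_left, conj_trivial]
  congr 1
  rw [← inner_smGrad, ← inner_smGrad, inner_smGrad q w', wmean, mul_sum, ← sum_sub_distrib, sum_div]
  exact sum_congr rfl fun i _ => by ring

lemma shiftedHess_isSymmetric (q : E) (σ : ℝ) : (shiftedHess a μ q σ).IsSymmetric := fun w w' => by
  have h : ⟪w, shiftedHess a μ q σ w'⟫ = ⟪shiftedHess a μ q σ w', w⟫ := real_inner_comm _ _
  rw [h, inner_shiftedHess, inner_shiftedHess, hessForm, hessForm, wcov_comm, real_inner_comm]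

lemma inner_shiftedHess_self (q w : E) (σ : ℝ) :
    ⟪shiftedHess a μ q σ w, w⟫ = hessForm a μ q w w + σ * ‖w‖ ^ 2 := by
  rw [inner_shiftedHess, real_inner_self_eq_norm_sq]

lemma mul_norm_sq_le_inner_shiftedHess (hμ : 0 < μ) (q w : E) (σ : ℝ) :
    σ * ‖w‖ ^ 2 ≤ ⟪shiftedHess a μ q σ w, w⟫ := by
  rw [inner_shiftedHess_self]
  linarith [hessForm_self_nonneg (a := a) hμ q w]

lemma hessForm_self_le_sum (hμ : 0 < μ) (q w : E) :
    hessForm a μ q w w ≤ (∑ i, gibbs a μ q i * ⟪a i, w⟫ ^ 2) / μ := by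
  unfold hessForm
  gcongr
  refine (wcov_self_le_sum_sq (sum_gibbs q) _ 0).trans_eq ?_
  simp only [sub_zero, sq]

lemma hessForm_self_le (hμ : 0 < μ) (ha : ∀ i, ‖a i‖ ≤ 1) (q w : E) :
    hessForm a μ q w w ≤ 1 / μ * ‖w‖ ^ 2 := by
  refine (hessForm_self_le_sum hμ q w).trans ?_
  rw [one_div_mul_eq_div]
  gcongr
  calc ∑ i, gibbs a μ q i * ⟪a i, w⟫ ^ 2 ≤ ∑ i, gibbs a μ q i * ‖w‖ ^ 2 := by
        refine sum_le_sum fun i _ => mul_le_mul_of_nonneg_left ?_ (gibbs_nonneg q i)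
        refine (inner_sq_le_norm_sq_mul _ _).trans ?_
        have := pow_le_one₀ (n := 2) (norm_nonneg (a i)) (ha i)
        exact mul_le_of_le_one_left (by positivity) this
    _ = _ := by rw [← sum_mul, sum_gibbs, one_mul]

lemma inner_shiftedHess_le (hμ : 0 < μ) (ha : ∀ i, ‖a i‖ ≤ 1) (q w : E) (σ : ℝ) :
    ⟪shiftedHess a μ q σ w, w⟫ ≤ (1 / μ + σ) * ‖w‖ ^ 2 := by
  rw [inner_shiftedHess_self, add_mul]
  linarith [hessForm_self_le hμ ha q w]

/-- The Hessian of the softmax has trace at most `1 / μ`, since it is dominated by a convex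
combination of the rank one operators given by the vectors `a i / √μ`. -/
lemma sum_inner_shiftedHess_sub_le (hμ : 0 < μ) (ha : ∀ i, ‖a i‖ ≤ 1) (q : E) (σ : ℝ) {N : ℕ}
    (b : OrthonormalBasis (Fin N) ℝ E) :
    ∑ j, (⟪shiftedHess a μ q σ (b j), b j⟫ - σ) ≤ 1 / μ := by
  calc ∑ j, (⟪shiftedHess a μ q σ (b j), b j⟫ - σ)
      ≤ ∑ j, (∑ i, gibbs a μ q i * ⟪a i, b j⟫ ^ 2) / μ := by
        refine sum_le_sum fun j _ => ?_
        rw [inner_shiftedHess_self, b.norm_eq_one]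
        linarith [hessForm_self_le_sum (a := a) hμ q (b j)]
    _ = (∑ i, gibbs a μ q i * ‖a i‖ ^ 2) / μ := by
        rw [← sum_div, sum_comm]
        congr 1
        refine sum_congr rfl fun i _ => ?_
        rw [← mul_sum, ← b.sum_sq_norm_inner_left (a i)]
        simp only [Real.norm_eq_abs, sq_abs]
    _ ≤ 1 / μ := by
        gcongr
        rw [← sum_gibbs (a := a) (μ := μ) q]
        refine sum_le_sum fun i _ => ?_
        exact mul_le_of_le_one_right (gibbs_nonneg q i) (pow_le_one₀ (norm_nonneg _) (ha i))

end Hessian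

/-! ### Regularized minimizers of the softmax -/

section Prox

variable {ι : Type*} [Fintype ι]
variable {E : Type*} [NormedAddCommGroup E] [InnerProductSpace ℝ E]
variable {a : ι → E} {μ : ℝ}

/-- The gradient at `x` of the softmax with the regularizer `c / 2 ‖x‖ ^ 2` and the proximal term
`lam / 2 ‖x - q‖ ^ 2`. -/
noncomputable def proxGrad (a : ι → E) (μ c lam : ℝ) (q x : E) : E :=
  smGrad a μ x + c • x + lam • (x - q)

lemma proxGrad_sub (c lam : ℝ) (q x z : E) :
    proxGrad a μ c lam q x - proxGrad a μ c lam q z =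
      (smGrad a μ x - smGrad a μ z) + (c + lam) • (x - z) := by
  simp only [proxGrad, smul_sub, add_smul]
  abel

variable [Nonempty ι]

lemma continuous_softmax : Continuous (softmax a μ) := by
  have h : Continuous (expSum a μ) := by unfold expSum; fun_prop
  exact continuous_const.mul (h.log fun x => (expSum_pos x).ne')

/-- The regularized softmax has a minimizer: it is coercive by its tangent at `b`, and its
derivative vanishes at a minimum. -/
lemma exists_smGrad_add_smul_eq_zero [FiniteDimensional ℝ E] (hμ : 0 < μ) {σ : ℝ} (hσ : 0 < σ)
    (b : E) : ∃ z, smGrad a μ z + σ • (z - b) = 0 := by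
  set f : E → ℝ := fun x => softmax a μ x + σ / 2 * ‖x - b‖ ^ 2 with hf
  have hcont : Continuous f := by
    have := continuous_softmax (a := a) (μ := μ)
    fun_prop
  obtain ⟨z, hz⟩ : ∃ z, ∀ x, f z ≤ f x := by
    refine hcont.exists_forall_le' b ?_
    have hK := (isCompact_closedBall b (2 * ‖smGrad a μ b‖ / σ)).compl_mem_cocompact
    filter_upwards [hK] with x hx
    have hx' : 2 * ‖smGrad a μ b‖ / σ < ‖x - b‖ := by
      simpa [dist_eq_norm] using hx
    rw [div_lt_iff₀ hσ] at hx'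
    have h1 := softmax_add_inner_le (a := a) hμ x b
    have h2 := (abs_le.1 (abs_real_inner_le_norm (smGrad a μ b) (x - b))).1
    have h3 : 0 ≤ ‖x - b‖ * (‖x - b‖ * σ - 2 * ‖smGrad a μ b‖) :=
      mul_nonneg (norm_nonneg _) (by linarith)
    simp only [hf, sub_self, norm_zero]
    nlinarith
  refine ⟨z, ?_⟩
  set G := smGrad a μ z + σ • (z - b) with hG
  -- compare `z` with `z - s • G` and let `s` tend to `0`
  have hev : ∀ s : ℝ, 0 < s →
      0 ≤ ⟪smGrad a μ (z + s • (-G)), -G⟫ + σ * ⟪z - b, -G⟫ + σ / 2 * ‖G‖ ^ 2 * s := by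
    intro s hs
    have h1 := softmax_add_inner_le (a := a) hμ z (z + s • (-G))
    have h2 := hz (z + s • (-G))
    have h3 : ‖z + s • (-G) - b‖ ^ 2 = ‖z - b‖ ^ 2 + 2 * (s * ⟪z - b, -G⟫) + s ^ 2 * ‖G‖ ^ 2 := by
      rw [add_sub_right_comm, norm_add_sq_real, inner_smul_right, norm_smul, mul_pow, norm_neg,
        Real.norm_eq_abs, sq_abs]
    simp only [hf, h3] at h2
    rw [sub_add_cancel_left, inner_neg_right, inner_smul_right] at h1
    have h4 : 0 ≤ s * (⟪smGrad a μ (z + s • (-G)), -G⟫ + σ * ⟪z - b, -G⟫ + σ / 2 * ‖G‖ ^ 2 * s) := by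
      nlinarith
    exact nonneg_of_mul_nonneg_right h4 hs
  have hlim : Filter.Tendsto
      (fun s : ℝ => ⟪smGrad a μ (z + s • (-G)), -G⟫ + σ * ⟪z - b, -G⟫ + σ / 2 * ‖G‖ ^ 2 * s)
      (nhdsWithin 0 (Set.Ioi 0)) (nhds (-‖G‖ ^ 2)) := by
    have hc : ContinuousAt
        (fun s : ℝ => ⟪smGrad a μ (z + s • (-G)), -G⟫ + σ * ⟪z - b, -G⟫ + σ / 2 * ‖G‖ ^ 2 * s) 0 :=
      ((hasDerivAt_inner_smGrad z (-G) (-G) 0).continuousAt.add continuousAt_const).add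
        (continuousAt_const.mul continuousAt_id)
    have hc' := hc.tendsto.mono_left (nhdsWithin_le_nhds (s := Set.Ioi 0))
    have hval : ⟪smGrad a μ (z + (0 : ℝ) • (-G)), -G⟫ + σ * ⟪z - b, -G⟫ + σ / 2 * ‖G‖ ^ 2 * 0 =
        -‖G‖ ^ 2 := by
      rw [zero_smul, add_zero, mul_zero, add_zero, ← real_inner_self_eq_norm_sq G]
      have hin : ⟪G, G⟫ = ⟪smGrad a μ z, G⟫ + σ * ⟪z - b, G⟫ := by
        conv_lhs => rw [hG]
        rw [← hG, inner_add_left, inner_smul_left, conj_trivial]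
      rw [hin, inner_neg_right, inner_neg_right]
      ring
    rwa [hval] at hc'
  have h0 : 0 ≤ -‖G‖ ^ 2 := ge_of_tendsto hlim (by
    filter_upwards [self_mem_nhdsWithin] with s hs using hev s hs)
  have : ‖G‖ ^ 2 = 0 := le_antisymm (by linarith) (by positivity)
  exact norm_eq_zero.1 (pow_eq_zero_iff two_ne_zero |>.1 this)

lemma exists_proxGrad_eq_zero [FiniteDimensional ℝ E] (hμ : 0 < μ) {c lam : ℝ}
    (h : 0 < c + lam) (q : E) : ∃ z, proxGrad a μ c lam q z = 0 := by
  obtain ⟨z, hz⟩ := exists_smGrad_add_smul_eq_zero (a := a) hμ h ((lam / (c + lam)) • q)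
  refine ⟨z, ?_⟩
  rw [← hz, proxGrad, smul_sub (c + lam), smul_smul, mul_div_cancel₀ _ h.ne', smul_sub, add_smul]
  abel

/-- Two proximal points with the same centre and the parameters `2 lam` and `lam` are close to
each other, even in the norm of the Hessian. This is what makes it possible to follow the path of
proximal points by steps that halve the parameter. -/
lemma proxGrad_path_step (hμ : 0 < μ) (ha : ∀ i, ‖a i‖ ≤ 1) {c lam r : ℝ} (hc : 0 ≤ c)
    (hlam : 0 < lam) (hr : 12 * r ≤ μ) {q z z' : E} (hz : proxGrad a μ c (2 * lam) q z = 0)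
    (hz' : proxGrad a μ c lam q z' = 0) (hzq : ‖z - q‖ ≤ 2 * r) :
    ‖z' - z‖ ≤ 2 * r ∧ ⟪shiftedHess a μ q (c + lam) (z' - z), z' - z⟫ ≤ 8 * lam * r ^ 2 := by
  have hkey : ⟪smGrad a μ z' - smGrad a μ z, z' - z⟫ + (c + lam) * ‖z' - z‖ ^ 2 =
      lam * ⟪z - q, z' - z⟫ := by
    have h1 : (smGrad a μ z' - smGrad a μ z) + (c + lam) • (z' - z) = lam • (z - q) := by
      rw [← proxGrad_sub, hz']
      have : proxGrad a μ c (2 * lam) q z = proxGrad a μ c lam q z + lam • (z - q) := by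
        simp only [proxGrad, two_mul, add_smul]; abel
      rw [this] at hz
      rw [zero_sub, neg_eq_iff_eq_neg]
      exact eq_neg_of_add_eq_zero_left hz
    have h2 := congrArg (fun v => ⟪v, z' - z⟫) h1
    simpa [inner_add_left, inner_smul_left] using h2
  have hcs : ⟪z - q, z' - z⟫ ≤ ‖z - q‖ * ‖z' - z‖ := real_inner_le_norm _ _
  have hmono := inner_smGrad_sub_nonneg (a := a) hμ z' z
  have hlamcs := mul_le_mul_of_nonneg_left hcs hlam.le
  have hd : ‖z' - z‖ ≤ ‖z - q‖ := by
    by_contra! hlt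
    have h0 : 0 < ‖z' - z‖ := (norm_nonneg _).trans_lt hlt
    have h1 : lam * ‖z' - z‖ * ‖z' - z‖ ≤ lam * ‖z - q‖ * ‖z' - z‖ := by
      have : 0 ≤ c * ‖z' - z‖ ^ 2 := by positivity
      nlinarith
    have h2 := le_of_mul_le_mul_right h1 h0
    have h3 := le_of_mul_le_mul_left h2 hlam
    linarith
  have hd2 : ‖z' - z‖ ≤ 2 * r := hd.trans hzq
  refine ⟨hd2, ?_⟩
  have hr0 : 0 ≤ r := by linarith [norm_nonneg (z - q)]
  have hz'q : ‖z' - q‖ ≤ μ / 3 := by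
    have : z' - q = (z' - z) + (z - q) := by abel
    rw [this]
    exact (norm_add_le _ _).trans (by linarith)
  have hhalf := half_hessForm_le_inner_smGrad_sub hμ ha hz'q (hzq.trans (by linarith))
  rw [inner_shiftedHess_self]
  have h4 : ‖z - q‖ * ‖z' - z‖ ≤ (2 * r) * (2 * r) := by gcongr
  have h5 := mul_le_mul_of_nonneg_left h4 hlam.le
  have h6 : 0 ≤ (c + lam) * ‖z' - z‖ ^ 2 := by positivity
  nlinarith

/-- Near the centre `q` the gradient of the proximal subproblem is comparable to the shifted Hessian
at `q`, applied to the distance from the proximal point `z`. These are the two hypotheses of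
`precond_step`. -/
lemma proxGrad_comparable (hμ : 0 < μ) (ha : ∀ i, ‖a i‖ ≤ 1) {c lam : ℝ}
    (hσ : 0 < c + lam) {q x z : E} (hz : proxGrad a μ c lam q z = 0) (hx : ‖x - q‖ ≤ μ / 3)
    (hzq : ‖z - q‖ ≤ μ / 3) :
    (∀ u, ⟪proxGrad a μ c lam q x, u⟫ ^ 2 ≤
        4 * ⟪shiftedHess a μ q (c + lam) (x - z), x - z⟫ * ⟪shiftedHess a μ q (c + lam) u, u⟫) ∧
      ⟪shiftedHess a μ q (c + lam) (x - z), x - z⟫ / 2 ≤ ⟪proxGrad a μ c lam q x, x - z⟫ := by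
  have hg : proxGrad a μ c lam q x = (smGrad a μ x - smGrad a μ z) + (c + lam) • (x - z) := by
    rw [← proxGrad_sub, hz, sub_zero]
  constructor
  · intro u
    rw [hg, inner_add_left, inner_smul_left, inner_shiftedHess_self, inner_shiftedHess_self]
    simp only [conj_trivial]
    have h1 := inner_smGrad_sub_sq_le hμ ha hx hzq u
    have h2 := mul_le_mul_of_nonneg_left (inner_sq_le_norm_sq_mul (x - z) u) (sq_nonneg (c + lam))
    have h3 := hessForm_self_nonneg (a := a) hμ q (x - z)
    have h4 := hessForm_self_nonneg (a := a) hμ q u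
    set A := ⟪smGrad a μ x - smGrad a μ z, u⟫
    set B := (c + lam) * ⟪x - z, u⟫ with hB
    set he := hessForm a μ q (x - z) (x - z)
    set hu := hessForm a μ q u u
    set e := (c + lam) * ‖x - z‖ ^ 2 with he_def
    set U := (c + lam) * ‖u‖ ^ 2 with hU_def
    have he0 : 0 ≤ e := by positivity
    have hU0 : 0 ≤ U := by positivity
    have hB2 : B ^ 2 ≤ e * U := by rw [hB, he_def, hU_def]; nlinarith
    have hAB : 2 * (A * B) ≤ 4 * (he * U + e * hu) := by
      refine (abs_le_of_sq_le_sq' ?_ (by positivity)).2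
      have h5 : A ^ 2 * B ^ 2 ≤ (4 * he * hu) * (e * U) :=
        mul_le_mul h1 hB2 (sq_nonneg _) (by positivity)
      nlinarith [sq_nonneg (he * U - e * hu)]
    nlinarith [mul_nonneg he0 hU0]
  · rw [hg, inner_add_left, inner_smul_left, inner_shiftedHess_self, real_inner_self_eq_norm_sq]
    simp only [conj_trivial]
    have h1 := half_hessForm_le_inner_smGrad_sub hμ ha hx hzq
    have h2 : 0 ≤ (c + lam) * ‖x - z‖ ^ 2 := by positivity
    linarith

end Prox

/-! ### A program logic for oracle algorithms -/

section Programs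

variable {m n : ℕ} {α β : Type}

/-- Sequential composition of oracle algorithms. -/
def OracleAlg.bind : OracleAlg m n α → (α → OracleAlg m n β) → OracleAlg m n β
  | .output a, f => f a
  | .query x y next, f => .query x y fun r => (next r).bind f

lemma OracleAlg.result_bind (A : Matrix (Fin m) (Fin n) ℝ) (alg : OracleAlg m n α)
    (f : α → OracleAlg m n β) : (alg.bind f).result A = (f (alg.result A)).result A := by
  induction alg with
  | output a => rfl
  | query x y next ih => exact ih _

lemma OracleAlg.numQueries_bind (A : Matrix (Fin m) (Fin n) ℝ) (alg : OracleAlg m n α)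
    (f : α → OracleAlg m n β) :
    (alg.bind f).numQueries A = alg.numQueries A + (f (alg.result A)).numQueries A := by
  induction alg with
  | output a => simp [OracleAlg.bind, OracleAlg.numQueries, OracleAlg.result]
  | query x y next ih =>
    simp only [OracleAlg.bind, OracleAlg.numQueries, OracleAlg.result, ih]
    omega

/-- `Solves N P` says that some oracle algorithm finds, for every matrix `A` with
`‖A‖_{2 → ∞} ≤ 1`, an object that has the property `P A`, with at most `N` queries. -/
def Solves (N : ℕ) (P : Matrix (Fin m) (Fin n) ℝ → α → Prop) : Prop :=
  ∃ alg : OracleAlg m n α, ∀ A, twoToInftyNorm A ≤ 1 →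
    P A (alg.result A) ∧ alg.numQueries A ≤ N

lemma Solves.pure {P : Matrix (Fin m) (Fin n) ℝ → α → Prop} (a : α)
    (h : ∀ A, twoToInftyNorm A ≤ 1 → P A a) (N : ℕ) : Solves N P :=
  ⟨.output a, fun A hA => ⟨h A hA, Nat.zero_le _⟩⟩

lemma Solves.mono {N N' : ℕ} {P P' : Matrix (Fin m) (Fin n) ℝ → α → Prop} (h : Solves N P)
    (hN : N ≤ N') (hP : ∀ A, twoToInftyNorm A ≤ 1 → ∀ a, P A a → P' A a) : Solves N' P' := by
  obtain ⟨alg, halg⟩ := h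
  exact ⟨alg, fun A hA => ⟨hP A hA _ (halg A hA).1, (halg A hA).2.trans hN⟩⟩

/-- The rule of sequential composition. The second algorithm is given the output `a` of the first,
and may rely on `P A a`, which is a hypothesis about the unknown matrix. -/
lemma Solves.bind {N N' : ℕ} {P : Matrix (Fin m) (Fin n) ℝ → α → Prop}
    {R : Matrix (Fin m) (Fin n) ℝ → β → Prop} (h : Solves N P)
    (h' : ∀ a, Solves N' fun A b => P A a → R A b) : Solves (N + N') R := by
  obtain ⟨alg, halg⟩ := h
  choose f hf using h'
  refine ⟨alg.bind f, fun A hA => ?_⟩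
  rw [OracleAlg.result_bind, OracleAlg.numQueries_bind]
  exact ⟨(hf _ A hA).1 (halg A hA).1, add_le_add (halg A hA).2 (hf _ A hA).2⟩

/-- A loop of `T` rounds with the invariant `I`. -/
lemma Solves.iterate {N : ℕ} (I : ℕ → Matrix (Fin m) (Fin n) ℝ → α → Prop) (T : ℕ)
    (h : ∀ t, t < T → ∀ a, Solves N fun A b => I t A a → I (t + 1) A b) (a : α) :
    Solves (T * N) fun A b => I 0 A a → I T A b := by
  induction T with
  | zero => exact Solves.pure a (fun A _ h => h) _
  | succ T ih =>
    rw [add_mul, one_mul]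
    refine Solves.bind (ih fun t ht => h t (ht.trans T.lt_succ_self)) fun b => ?_
    exact (h T T.lt_succ_self b).mono le_rfl fun A _ c hc hb h0 => hc (hb h0)

lemma solves_query (x : Fin n → ℝ) (y : Fin m → ℝ) :
    Solves 1 fun (A : Matrix (Fin m) (Fin n) ℝ) r => r = oracle A x y :=
  ⟨.query x y .output, fun _ _ => ⟨rfl, le_rfl⟩⟩

end Programs

/-! ### Gradients, Hessians and linear systems from matrix-vector products -/

section Primitives

variable {m n : ℕ}

/-- The rows of a matrix as vectors of a Euclidean space. -/
def rows (A : Matrix (Fin m) (Fin n) ℝ) (i : Fin m) : EuclideanSpace ℝ (Fin n) :=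
  WithLp.toLp 2 (A i)

lemma norm_rows_le {A : Matrix (Fin m) (Fin n) ℝ} (hA : twoToInftyNorm A ≤ 1) (i : Fin m) :
    ‖rows A i‖ ≤ 1 := by
  refine le_trans ?_ hA
  rw [rows, EuclideanSpace.norm_eq]
  simp only [Real.norm_eq_abs, sq_abs]
  exact le_ciSup (f := fun i => √(∑ j, A i j ^ 2)) (Set.finite_range _).bddAbove i

lemma inner_rows (A : Matrix (Fin m) (Fin n) ℝ) (i : Fin m) (x : EuclideanSpace ℝ (Fin n)) :
    ⟪rows A i, x⟫ = (A.mulVec x.ofLp) i := by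
  simp [rows, PiLp.inner_apply, Matrix.mulVec, dotProduct, mul_comm]

lemma sum_smul_rows (A : Matrix (Fin m) (Fin n) ℝ) (y : Fin m → ℝ) :
    ∑ i, y i • rows A i = WithLp.toLp 2 (A.transpose.mulVec y) := by
  ext j
  simp [rows, Matrix.mulVec, dotProduct, mul_comm]

lemma solves_inner_rows (x : EuclideanSpace ℝ (Fin n)) :
    Solves 1 fun (A : Matrix (Fin m) (Fin n) ℝ) b => b = fun i => ⟪rows A i, x⟫ :=
  (solves_query x.ofLp 0).bind (N' := 0) fun r => Solves.pure r.1 (fun A _ h => by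
    funext i
    rw [inner_rows, h]
    rfl) 0

lemma solves_sum_smul_rows (y : Fin m → ℝ) :
    Solves 1 fun (A : Matrix (Fin m) (Fin n) ℝ) v => v = ∑ i, y i • rows A i :=
  (solves_query 0 y).bind (N' := 0) fun r => Solves.pure (WithLp.toLp 2 r.2) (fun A _ h => by
    rw [sum_smul_rows, h]
    rfl) 0

lemma solves_gibbs (μ : ℝ) (x : EuclideanSpace ℝ (Fin n)) :
    Solves 1 fun (A : Matrix (Fin m) (Fin n) ℝ) p => p = gibbs (rows A) μ x :=
  (solves_inner_rows x).bind (N' := 0) fun b =>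
    Solves.pure (fun i => exp (b i / μ) / ∑ i, exp (b i / μ)) (fun A _ h => by
      subst h
      rfl) 0

lemma solves_smGrad (μ : ℝ) (x : EuclideanSpace ℝ (Fin n)) :
    Solves 2 fun (A : Matrix (Fin m) (Fin n) ℝ)
        (r : (Fin m → ℝ) × EuclideanSpace ℝ (Fin n)) =>
      r.1 = gibbs (rows A) μ x ∧ r.2 = smGrad (rows A) μ x :=
  (solves_gibbs μ x).bind fun p => (solves_sum_smul_rows p).bind (N' := 0) fun g =>
    Solves.pure (p, g) (fun A _ hg hp => ⟨hp, by rw [hg, hp]; rfl⟩) 0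

lemma solves_shiftedHess (μ σ : ℝ) (q w : EuclideanSpace ℝ (Fin n)) (p : Fin m → ℝ) :
    Solves 2 fun (A : Matrix (Fin m) (Fin n) ℝ) v =>
      p = gibbs (rows A) μ q → v = shiftedHess (rows A) μ q σ w :=
  (solves_inner_rows w).bind fun b =>
    (solves_sum_smul_rows fun i => p i * (b i - wmean p b) / μ).bind (N' := 0) fun v =>
      Solves.pure (v + σ • w) (fun A _ hv hb hp => by
        subst hb
        rw [hv, shiftedHess_apply, inner_smGrad, ← hp]) 0

lemma solves_krylov (μ σ : ℝ) (q g : EuclideanSpace ℝ (Fin n)) (p : Fin m → ℝ) (J : ℕ) :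
    Solves (J * 2) fun (A : Matrix (Fin m) (Fin n) ℝ) (w : ℕ → EuclideanSpace ℝ (Fin n)) =>
      p = gibbs (rows A) μ q → ∀ i ≤ J, w i = (shiftedHess (rows A) μ q σ ^ i) g := by
  refine (Solves.iterate (fun t A (w : ℕ → EuclideanSpace ℝ (Fin n)) =>
    p = gibbs (rows A) μ q → ∀ i ≤ t, w i = (shiftedHess (rows A) μ q σ ^ i) g) J
    (fun t _ w => ?_) fun _ => g).mono le_rfl fun A _ w hw => hw fun _ i hi => by
      rw [Nat.le_zero.1 hi, pow_zero]; rfl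
  refine (solves_shiftedHess μ σ q (w t) p).bind (N' := 0) fun v =>
    Solves.pure (Function.update w (t + 1) v) (fun A _ hv hw hp i hi => ?_) 0
  rcases hi.eq_or_lt with rfl | hi
  · rw [Function.update_self, hv hp, hw hp t le_rfl, pow_succ', Module.End.mul_apply]
  · rw [Function.update_of_ne hi.ne, hw hp i (Nat.lt_succ_iff.1 hi)]

/-- A linear system with the shifted Hessian is solved from the Krylov vectors, without any further
query: since the Krylov vectors include the images of those before them, the residual of each of
their combinations is known. -/
lemma solves_linear_system [NeZero m] {μ σ δ : ℝ} (hμ : 0 < μ) (hσ : 0 < σ) {k j : ℕ} (hk : 0 < k)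
    (hδ : 2 * exp (-(j / √(1 + 1 / μ / (k * σ)))) ≤ δ) (q g : EuclideanSpace ℝ (Fin n))
    (p : Fin m → ℝ) :
    Solves ((k + j) * 2) fun (A : Matrix (Fin m) (Fin n) ℝ) w =>
      p = gibbs (rows A) μ q → ‖shiftedHess (rows A) μ q σ w - g‖ ≤ δ * ‖g‖ := by
  refine (solves_krylov μ σ q g p (k + j)).bind (N' := 0) fun w => ?_
  by_cases h : ∃ c : ℕ → ℝ, ‖∑ i ∈ range (k + j), c i • w (i + 1) - g‖ ≤ δ * ‖g‖
  · obtain ⟨c, hc⟩ := h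
    refine Solves.pure (∑ i ∈ range (k + j), c i • w i) (fun A _ hw hp => ?_) 0
    have he : shiftedHess (rows A) μ q σ (∑ i ∈ range (k + j), c i • w i) =
        ∑ i ∈ range (k + j), c i • w (i + 1) := by
      rw [map_sum]
      refine sum_congr rfl fun i hi => ?_
      have hi' := mem_range.1 hi
      rw [map_smul, hw hp i hi'.le, hw hp (i + 1) hi', pow_succ', Module.End.mul_apply]
    rwa [he]
  · refine Solves.pure 0 (fun A hA hw hp => absurd ?_ h) 0
    obtain ⟨c, hc⟩ := exists_krylov_residual_le (shiftedHess_isSymmetric (a := rows A) q σ) hσ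
      (one_div_pos.2 hμ) (fun w => mul_norm_sq_le_inner_shiftedHess hμ q w σ)
      (fun b => sum_inner_shiftedHess_sub_le hμ (norm_rows_le hA) q σ b) hk hδ g
    have he : ∑ i ∈ range (k + j), c i • w (i + 1) =
        ∑ i ∈ range (k + j), c i • (shiftedHess (rows A) μ q σ ^ (i + 1)) g :=
      sum_congr rfl fun i hi => by rw [hw hp (i + 1) (mem_range.1 hi)]
    exact ⟨c, by rwa [he]⟩

end Primitives

/-! ### The proximal subproblem -/

section ProxSolver

variable {m n : ℕ} [NeZero m]

/-- The squared norm of `e` in which the proximal subproblem with parameter `lam` and centre `q` is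
well conditioned. -/
noncomputable def proxEnergy (A : Matrix (Fin m) (Fin n) ℝ) (μ c lam : ℝ)
    (q e : EuclideanSpace ℝ (Fin n)) : ℝ :=
  ⟪shiftedHess (rows A) μ q (c + lam) e, e⟫

/-- `N` preconditioned gradient steps for the proximal subproblem. The constants are such that the
iterates stay in the ball of radius `9 r ≤ μ / 3` about the centre. -/
lemma solves_prox_steps {μ c lam lam₀ r δ : ℝ} (hμ : 0 < μ) (hc : 0 ≤ c) (hlam₀ : 0 < lam₀)
    (hlam : lam₀ ≤ lam) (hr0 : 0 < r) (hr : 27 * r ≤ μ) {k j : ℕ} (hk : 0 < k)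
    (hδ : 2 * exp (-(j / √(1 + 1 / μ / (k * lam₀)))) ≤ δ)
    (hδ' : 1024 * δ ^ 2 * (1 / μ + lam₀) ≤ lam₀)
    (N : ℕ) (q x : EuclideanSpace ℝ (Fin n)) (p : Fin m → ℝ) :
    Solves (N * (2 + (k + j) * 2)) fun (A : Matrix (Fin m) (Fin n) ℝ) x' =>
      p = gibbs (rows A) μ q → ∀ z, proxGrad (rows A) μ c lam q z = 0 → ‖z - q‖ ≤ 4 * r →
        proxEnergy A μ c lam q (x - z) ≤ 25 * lam * r ^ 2 →
        proxEnergy A μ c lam q (x' - z) ≤ (63 / 64) ^ N * (25 * lam * r ^ 2) := by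
  have hlampos : 0 < lam := hlam₀.trans_le hlam
  have hσ : 0 < c + lam := by linarith
  have hσ₀ : lam₀ ≤ c + lam := by linarith
  have hk' : (0 : ℝ) < k := by exact_mod_cast hk
  have hδ0 : 0 ≤ δ := le_trans (by positivity) hδ
  have hδσ : 2 * exp (-(j / √(1 + 1 / μ / (k * (c + lam))))) ≤ δ := by
    refine le_trans ?_ hδ
    gcongr
  have hδσ' : 1024 * δ ^ 2 * (1 / μ + (c + lam)) ≤ c + lam := by
    have h1 : 1024 * δ ^ 2 ≤ 1 := by
      have : 0 < 1 / μ := by positivity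
      by_contra! h
      nlinarith
    nlinarith
  refine (Solves.iterate (fun t A x' =>
    p = gibbs (rows A) μ q → ∀ z, proxGrad (rows A) μ c lam q z = 0 → ‖z - q‖ ≤ 4 * r →
        proxEnergy A μ c lam q (x - z) ≤ 25 * lam * r ^ 2 →
        proxEnergy A μ c lam q (x' - z) ≤ (63 / 64) ^ t * (25 * lam * r ^ 2)) N
    (fun t _ x => ?_) x).mono le_rfl fun A _ w hw => hw fun _ z _ _ h => by simpa using h
  refine (solves_smGrad μ x).bind fun s =>
    (solves_linear_system hμ hσ hk hδσ q (s.2 + c • x + lam • (x - q)) p).bind (N' := 0) fun w =>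
    Solves.pure (x - (1 / 32 : ℝ) • w) (fun A hA hw hs hx hp z hz hzq hz0 => ?_) 0
  have hx' := hx hp z hz hzq hz0
  have hw' := hw hp
  rw [hs.2] at hw'
  change ‖shiftedHess (rows A) μ q (c + lam) w - proxGrad (rows A) μ c lam q x‖ ≤
    δ * ‖proxGrad (rows A) μ c lam q x‖ at hw'
  have ha := norm_rows_le hA
  have hle1 : ((63 : ℝ) / 64) ^ t ≤ 1 := pow_le_one₀ (by norm_num) (by norm_num)
  have hxz : ‖x - z‖ ≤ 5 * r := by
    have h1 : lam * ‖x - z‖ ^ 2 ≤ proxEnergy A μ c lam q (x - z) :=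
      le_trans (by gcongr; linarith) (mul_norm_sq_le_inner_shiftedHess hμ q (x - z) (c + lam))
    have h2 : (63 / 64 : ℝ) ^ t * (25 * lam * r ^ 2) ≤ 25 * lam * r ^ 2 :=
      mul_le_of_le_one_left (by positivity) hle1
    have h3 : lam * ‖x - z‖ ^ 2 ≤ lam * (5 * r) ^ 2 := by nlinarith
    exact le_of_sq_le_sq (le_of_mul_le_mul_left h3 hlampos) (by linarith)
  have hxq : ‖x - q‖ ≤ μ / 3 := by
    have : x - q = (x - z) + (z - q) := by abel
    rw [this]
    exact (norm_add_le _ _).trans (by linarith)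
  obtain ⟨h1, h2⟩ := proxGrad_comparable hμ ha hσ hz hxq (hzq.trans (by linarith))
  have h3 := precond_step (shiftedHess_isSymmetric q (c + lam)) hσ (by positivity)
    (fun w => mul_norm_sq_le_inner_shiftedHess hμ q w (c + lam))
    (fun w => inner_shiftedHess_le hμ ha q w (c + lam)) hδσ' h1 h2 hw'
  have he : x - (1 / 32 : ℝ) • w - z = x - z - (1 / 32 : ℝ) • w := by abel
  unfold proxEnergy at hx' ⊢
  rw [he, pow_succ']
  linarith

/-- The outcome of the proximal subproblem with centre `q` and smallest parameter `lam₀`: a point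
`x` that is almost stationary for some parameter `lam ≥ lam₀`, and which has moved by at least `r`
unless `lam = lam₀`. The tuple also holds the Gibbs weights and the softmax gradient at `x`. -/
def IsProxStep (A : Matrix (Fin m) (Fin n) ℝ) (μ c lam₀ r e₀ : ℝ) (q : EuclideanSpace ℝ (Fin n))
    (s : EuclideanSpace ℝ (Fin n) × ℝ × (Fin m → ℝ) × EuclideanSpace ℝ (Fin n)) : Prop :=
  lam₀ ≤ s.2.1 ∧ (s.2.1 = lam₀ ∨ r ≤ ‖s.1 - q‖) ∧
    ‖proxGrad (rows A) μ c s.2.1 q s.1‖ ≤ lam₀ * e₀ ∧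
    s.2.2.1 = gibbs (rows A) μ s.1 ∧ s.2.2.2 = smGrad (rows A) μ s.1

/-- The proximal subproblem is solved by following the path of proximal points from a large
parameter, where the proximal point is close to the centre `q`, down to `lam₀`, and by stopping as
soon as the distance from `q` exceeds `r`. -/
lemma solves_prox {μ c lam₀ r δ e₀ Q : ℝ} (hμ : 0 < μ) (hc : 0 ≤ c) (hc1 : c ≤ 1)
    (hlam₀ : 0 < lam₀) (hr0 : 0 < r) (hr : 27 * r ≤ μ) (he₀ : 0 ≤ e₀) {k j : ℕ} (hk : 0 < k)
    (hδ : 2 * exp (-(j / √(1 + 1 / μ / (k * lam₀)))) ≤ δ)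
    (hδ' : 1024 * δ ^ 2 * (1 / μ + lam₀) ≤ lam₀) {N S : ℕ}
    (hN : (63 / 64 : ℝ) ^ N * 25 ≤ 1)
    (hN' : 100 * (63 / 64 : ℝ) ^ N * (2 ^ S * lam₀) * r ^ 2 * (1 / μ + 1 + 2 ^ S * lam₀) ≤
      (lam₀ * e₀) ^ 2)
    (hS : 1 + Q ≤ 2 ^ S * lam₀ * r) (hS' : 1 / μ + 1 ≤ 2 ^ S * lam₀)
    (q : EuclideanSpace ℝ (Fin n)) :
    Solves ((S + 1) * (N * (2 + (k + j) * 2)) + 3) fun (A : Matrix (Fin m) (Fin n) ℝ) s =>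
      ‖q‖ ≤ Q → IsProxStep A μ c lam₀ r e₀ q s := by
  have hμ1 : 0 < 1 / μ := by positivity
  have hNN : (0 : ℝ) ≤ (63 / 64) ^ N := by positivity
  -- a point of small energy is close to the proximal point and almost stationary
  have hfin : ∀ A : Matrix (Fin m) (Fin n) ℝ, twoToInftyNorm A ≤ 1 → ∀ lam, lam₀ ≤ lam →
      lam ≤ 2 ^ S * lam₀ → ∀ x z, proxGrad (rows A) μ c lam q z = 0 → ‖z - q‖ ≤ 4 * r →
      proxEnergy A μ c lam q (x - z) ≤ (63 / 64) ^ N * (25 * lam * r ^ 2) →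
      ‖x - z‖ ≤ r ∧ ‖proxGrad (rows A) μ c lam q x‖ ≤ lam₀ * e₀ := by
    intro A hA lam hlam hlam' x z hz hzq hm
    have hlampos : 0 < lam := hlam₀.trans_le hlam
    have ha := norm_rows_le hA
    have hxz : ‖x - z‖ ≤ r := by
      have h1 : lam * ‖x - z‖ ^ 2 ≤ proxEnergy A μ c lam q (x - z) :=
        le_trans (by gcongr; linarith) (mul_norm_sq_le_inner_shiftedHess hμ q (x - z) (c + lam))
      have h2 : (63 / 64 : ℝ) ^ N * 25 * (lam * r ^ 2) ≤ 1 * (lam * r ^ 2) := by gcongr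
      have h3 : lam * ‖x - z‖ ^ 2 ≤ lam * r ^ 2 := by nlinarith
      exact le_of_sq_le_sq (le_of_mul_le_mul_left h3 hlampos) hr0.le
    refine ⟨hxz, ?_⟩
    have hxq : ‖x - q‖ ≤ μ / 3 := by
      have : x - q = (x - z) + (z - q) := by abel
      rw [this]
      exact (norm_add_le _ _).trans (by linarith)
    have hm0 : 0 ≤ proxEnergy A μ c lam q (x - z) :=
      le_trans (by positivity) (mul_norm_sq_le_inner_shiftedHess hμ q (x - z) (c + lam))
    have h1 := norm_sq_le_of_inner_sq_le (by positivity)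
      (fun w => inner_shiftedHess_le hμ ha q w (c + lam)) hm0
      (proxGrad_comparable hμ ha (by linarith) hz hxq (hzq.trans (by linarith))).1
    refine le_of_sq_le_sq (h1.trans (le_trans ?_ hN')) (by positivity)
    calc 4 * proxEnergy A μ c lam q (x - z) * (1 / μ + (c + lam))
        ≤ 4 * ((63 / 64) ^ N * (25 * (2 ^ S * lam₀) * r ^ 2)) * (1 / μ + (1 + 2 ^ S * lam₀)) := by
          gcongr
          exact hm.trans (by gcongr)
      _ = _ := by ring
  -- the state is the current point, its parameter, and whether the loop has stopped
  let I : Matrix (Fin m) (Fin n) ℝ → ℕ → EuclideanSpace ℝ (Fin n) × ℝ × Bool → Prop :=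
    fun A t s => lam₀ ≤ s.2.1 ∧ ‖proxGrad (rows A) μ c s.2.1 q s.1‖ ≤ lam₀ * e₀ ∧
      (s.2.2 = true → r ≤ ‖s.1 - q‖) ∧
      (s.2.2 = false → s.2.1 * 2 ^ t = 2 ^ S * lam₀ ∧ ∃ z, proxGrad (rows A) μ c s.2.1 q z = 0 ∧
        ‖s.1 - z‖ ≤ r ∧ proxEnergy A μ c s.2.1 q (s.1 - z) ≤ s.2.1 * r ^ 2)
  have hstart : ∀ p : Fin m → ℝ, Solves (N * (2 + (k + j) * 2))
      fun (A : Matrix (Fin m) (Fin n) ℝ) s => ‖q‖ ≤ Q → p = gibbs (rows A) μ q → I A 0 s := by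
    intro p
    have h2S : lam₀ ≤ 2 ^ S * lam₀ := le_mul_of_one_le_left hlam₀.le (one_le_pow₀ (by norm_num))
    refine (solves_prox_steps hμ hc hlam₀ h2S hr0 hr hk hδ hδ' N q q p).bind (N' := 0) fun x =>
      Solves.pure (x, 2 ^ S * lam₀, false) (fun A hA hx hq hp => ?_) 0
    set lam := 2 ^ S * lam₀
    have hlampos : 0 < lam := hlam₀.trans_le h2S
    have ha := norm_rows_le hA
    obtain ⟨z, hz⟩ := exists_proxGrad_eq_zero (a := rows A) hμ (by linarith : 0 < c + lam) q
    have hqz : ‖q - z‖ ≤ r := by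
      have h1 := proxGrad_sub (a := rows A) (μ := μ) c lam q q z
      rw [hz, sub_zero] at h1
      have h2 := congrArg (fun v => ⟪v, q - z⟫) h1
      simp only [inner_add_left, inner_smul_left, conj_trivial, real_inner_self_eq_norm_sq] at h2
      have h3 := inner_smGrad_sub_nonneg (a := rows A) hμ q z
      have h4 : ‖proxGrad (rows A) μ c lam q q‖ ≤ 1 + Q := by
        rw [proxGrad, sub_self, smul_zero, add_zero]
        refine (norm_add_le _ _).trans (add_le_add (norm_smGrad_le ha q) ?_)
        rw [norm_smul, Real.norm_of_nonneg hc]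
        exact (mul_le_of_le_one_left (norm_nonneg _) hc1).trans hq
      have h5 := real_inner_le_norm (proxGrad (rows A) μ c lam q q) (q - z)
      have h6 : ‖proxGrad (rows A) μ c lam q q‖ * ‖q - z‖ ≤ lam * r * ‖q - z‖ := by
        gcongr; exact h4.trans hS
      by_contra! hlt
      have h7 : 0 < ‖q - z‖ := hr0.trans hlt
      have h8 : lam * r * ‖q - z‖ < lam * ‖q - z‖ * ‖q - z‖ := by gcongr
      have h9 : 0 ≤ c * ‖q - z‖ ^ 2 := by positivity
      nlinarith
    have hzq : ‖z - q‖ ≤ 4 * r := by rw [norm_sub_rev]; linarith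
    have h0 : proxEnergy A μ c lam q (q - z) ≤ 25 * lam * r ^ 2 := by
      calc proxEnergy A μ c lam q (q - z) ≤ (1 / μ + (c + lam)) * ‖q - z‖ ^ 2 :=
            inner_shiftedHess_le hμ ha q _ _
        _ ≤ (25 * lam) * r ^ 2 := by gcongr; linarith
    have h1 := hx hp z hz hzq h0
    obtain ⟨h2, h3⟩ := hfin A hA lam h2S le_rfl x z hz hzq h1
    refine ⟨h2S, h3, by simp, fun _ => ⟨by simp [lam], z, hz, h2, h1.trans ?_⟩⟩
    have h4 : (63 / 64 : ℝ) ^ N * 25 * (lam * r ^ 2) ≤ 1 * (lam * r ^ 2) := by gcongr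
    simp only
    linarith
  have hstep : ∀ (p : Fin m → ℝ) (t : ℕ), t < S → ∀ s, Solves (N * (2 + (k + j) * 2))
      fun (A : Matrix (Fin m) (Fin n) ℝ) s' => (p = gibbs (rows A) μ q → I A t s) →
        (p = gibbs (rows A) μ q → I A (t + 1) s') := by
    rintro p t htS ⟨x, lam, b⟩
    rcases b with _ | _
    swap
    · refine Solves.pure (x, lam, true) (fun A _ h hp => ?_) _
      obtain ⟨h1, h2, h3, h4⟩ := h hp
      exact ⟨h1, h2, h3, by simp⟩
    by_cases hxq : r ≤ ‖x - q‖
    · refine Solves.pure (x, lam, true) (fun A _ h hp => ?_) _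
      obtain ⟨h1, h2, h3, h4⟩ := h hp
      exact ⟨h1, h2, fun _ => hxq, by simp⟩
    by_cases hlamt : lam * 2 ^ t = 2 ^ S * lam₀
    swap
    · exact Solves.pure (x, lam, true) (fun A _ h hp => absurd ((h hp).2.2.2 rfl).1 hlamt) _
    have hlam2 : lam / 2 * 2 ^ (t + 1) = 2 ^ S * lam₀ := by rw [← hlamt, pow_succ]; ring
    have hlam : lam₀ ≤ lam / 2 := by
      have h1 : (2 : ℝ) ^ (t + 1) ≤ 2 ^ S := pow_le_pow_right₀ (by norm_num) htS
      have h2 : lam₀ * 2 ^ (t + 1) ≤ lam / 2 * 2 ^ (t + 1) := by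
        rw [hlam2, mul_comm]; gcongr
      exact le_of_mul_le_mul_right h2 (by positivity)
    have hlam' : lam / 2 ≤ 2 ^ S * lam₀ := by
      rw [← hlam2]
      exact le_mul_of_one_le_right (by linarith) (one_le_pow₀ (by norm_num))
    refine (solves_prox_steps hμ hc hlam₀ hlam hr0 hr hk hδ hδ' N q x p).bind (N' := 0) fun x' =>
      Solves.pure (x', lam / 2, false) (fun A hA hx' h hp => ?_) 0
    obtain ⟨h1, h2, h3, h4⟩ := h hp
    obtain ⟨-, z, hz, hxz, hm⟩ := h4 rfl
    simp only at h1 h2 hz hxz hm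
    have ha := norm_rows_le hA
    have hlampos : 0 < lam := by linarith
    obtain ⟨z', hz'⟩ := exists_proxGrad_eq_zero (a := rows A) hμ (by linarith : 0 < c + lam / 2) q
    have hzq : ‖z - q‖ ≤ 2 * r := by
      have : z - q = -(x - z) + (x - q) := by abel
      rw [this]
      refine (norm_add_le _ _).trans ?_
      rw [norm_neg]
      linarith
    obtain ⟨hd, hE⟩ := proxGrad_path_step (lam := lam / 2) hμ ha hc (by linarith) (by linarith)
      (by rwa [mul_div_cancel₀ _ two_ne_zero]) hz' hzq
    have hz'q : ‖z' - q‖ ≤ 4 * r := by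
      have : z' - q = (z' - z) + (z - q) := by abel
      rw [this]
      exact (norm_add_le _ _).trans (by linarith)
    have hE0 : proxEnergy A μ c (lam / 2) q (x - z') ≤ 25 * (lam / 2) * r ^ 2 := by
      have h5 : proxEnergy A μ c (lam / 2) q (x - z) ≤ lam * r ^ 2 := by
        refine le_trans ?_ hm
        unfold proxEnergy
        rw [inner_shiftedHess_self, inner_shiftedHess_self]
        gcongr
        linarith
      -- the parallelogram inequality in the norm of the shifted Hessian
      have h6 : proxEnergy A μ c (lam / 2) q (x - z') ≤
          2 * proxEnergy A μ c (lam / 2) q (x - z) +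
          2 * ⟪shiftedHess (rows A) μ q (c + lam / 2) (z' - z), z' - z⟫ := by
        have h7 : 0 ≤ ⟪shiftedHess (rows A) μ q (c + lam / 2) ((x - z) + (z' - z)),
            (x - z) + (z' - z)⟫ :=
          le_trans (by positivity) (mul_norm_sq_le_inner_shiftedHess hμ q _ (c + lam / 2))
        have h8 : x - z' = (x - z) - (z' - z) := by abel
        unfold proxEnergy
        rw [h8]
        generalize x - z = u at *
        generalize z' - z = v at *
        simp only [map_add, map_sub, inner_add_left, inner_add_right, inner_sub_left,
          inner_sub_right] at h7 ⊢
        linarith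
      nlinarith
    have h5 := hx' hp z' hz' hz'q hE0
    obtain ⟨h6, h7⟩ := hfin A hA (lam / 2) hlam hlam' x' z' hz' hz'q h5
    refine ⟨hlam, h7, by simp, fun _ => ⟨hlam2, z', hz', h6, h5.trans ?_⟩⟩
    have h8 : (63 / 64 : ℝ) ^ N * 25 * (lam / 2 * r ^ 2) ≤ 1 * (lam / 2 * r ^ 2) := by gcongr
    simp only
    linarith
  have hcost : (S + 1) * (N * (2 + (k + j) * 2)) + 3 =
      1 + (N * (2 + (k + j) * 2) + (S * (N * (2 + (k + j) * 2)) + 2)) := by ring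
  rw [hcost]
  refine (solves_gibbs μ q).bind fun p => (hstart p).bind fun s₀ =>
    (Solves.iterate (fun t A s => p = gibbs (rows A) μ q → I A t s) S (hstep p) s₀).bind fun s =>
    (solves_smGrad μ s.1).bind (N' := 0) fun v =>
    Solves.pure (s.1, s.2.1, v) (fun A hA hv hs hs₀ hp hq => ?_) 0
  obtain ⟨h1, h2, h3, h4⟩ := hs (fun _ => hs₀ hq hp) hp
  refine ⟨h1, ?_, h2, hv⟩
  rcases hb : s.2.2 with _ | _
  · left
    have := (h4 hb).1
    rw [mul_comm] at this
    exact mul_left_cancel₀ (by positivity) this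
  · exact Or.inr (h3 hb)

end ProxSolver

/-! ### One step of the accelerated proximal method -/

section Acceleration

variable {ι : Type*} [Fintype ι]
variable {E : Type*} [NormedAddCommGroup E] [InnerProductSpace ℝ E]

/-- The softmax with the regularizer `c / 2 ‖x‖ ^ 2`. -/
noncomputable def regSoftmax (a : ι → E) (μ c : ℝ) (x : E) : ℝ := softmax a μ x + c / 2 * ‖x‖ ^ 2

variable [Nonempty ι] {a : ι → E} {μ : ℝ}

lemma half_norm_sq_eq_tangent (x z : E) :
    ‖x‖ ^ 2 / 2 = ‖z‖ ^ 2 / 2 + ⟪z, x - z⟫ + ‖x - z‖ ^ 2 / 2 := by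
  rw [norm_sub_sq_real, inner_sub_right, real_inner_self_eq_norm_sq, real_inner_comm]
  ring

lemma regSoftmax_strong_tangent (hμ : 0 < μ) (c : ℝ) (x z : E) :
    regSoftmax a μ c z + ⟪smGrad a μ z + c • z, x - z⟫ + c / 2 * ‖x - z‖ ^ 2 ≤
      regSoftmax a μ c x := by
  have h1 := softmax_add_inner_le (a := a) hμ x z
  have h2 := half_norm_sq_eq_tangent x z
  have h3 : c * (‖x‖ ^ 2 / 2) = c * (‖z‖ ^ 2 / 2 + ⟪z, x - z⟫ + ‖x - z‖ ^ 2 / 2) :=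
    congrArg (fun t => c * t) h2
  rw [regSoftmax, regSoftmax, inner_add_left, inner_smul_left, conj_trivial]
  linarith

lemma regSoftmax_tangent (hμ : 0 < μ) {c : ℝ} (hc : 0 ≤ c) (x z : E) :
    regSoftmax a μ c z + ⟪smGrad a μ z + c • z, x - z⟫ ≤ regSoftmax a μ c x := by
  have h1 := regSoftmax_strong_tangent (a := a) hμ c x z
  have h2 : 0 ≤ c / 2 * ‖x - z‖ ^ 2 := by positivity
  linarith

/-- The tangent of the regularized softmax at `x` is, up to entropy and regularizer at `u`, the
payoff of `u` against the Gibbs weights at `x`. Averages of these bounds certify a regularized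
solution. -/
lemma regSoftmax_tangent_le_entropy (hμ : 0 < μ) {c : ℝ} (hc : 0 ≤ c) (x u : E) :
    regSoftmax a μ c x + ⟪smGrad a μ x + c • x, u - x⟫ ≤
      ⟪smGrad a μ x, u⟫ + (μ * log (Fintype.card ι) + c / 2 * ‖u‖ ^ 2) := by
  have h1 := softmax_add_inner_le_entropy (a := a) hμ x u
  have h2 := half_norm_sq_eq_tangent u x
  have h3 : 0 ≤ c / 2 * ‖u - x‖ ^ 2 := by positivity
  rw [regSoftmax, inner_add_left, inner_smul_left, conj_trivial]
  nlinarith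

/-- A step of the accelerated proximal method of Monteiro and Svaiter with momentum damping. The
step size is planned for the proximal parameter `lam₀`. If the proximal step comes with a larger
parameter `lam`, everything is damped by the factor `lam₀ / lam`. In either case the potential
decreases by a multiple of the squared length of the proximal step. -/
lemma accelerated_step (hμ : 0 < μ) {c : ℝ} (hc : 0 ≤ c) {A A' b' lam₀ lam e₀ : ℝ} (hA : 0 < A)
    (hb' : 0 < b') (hA' : A' = A + b') (hlam₀ : 0 < lam₀) (hlam : lam₀ ≤ lam)
    (hstep : lam₀ * b' ^ 2 = A') {x v q y : E} (hq : A' • q = A • x + b' • v)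
    (hy : ‖smGrad a μ y + c • y + lam • (y - q)‖ ≤ lam₀ * e₀) {γ : ℝ} (hγ : γ = lam₀ / lam) (u : E) :
    (A + γ * b') * regSoftmax a μ c
        (((1 - γ) * A / (A + γ * b')) • x + (γ * A' / (A + γ * b')) • y) +
      ‖v - (γ * b') • (smGrad a μ y + c • y) - u‖ ^ 2 / 2 ≤
    A * regSoftmax a μ c x + ‖v - u‖ ^ 2 / 2 +
      γ * b' * (regSoftmax a μ c y + ⟪smGrad a μ y + c • y, u - y⟫) -
      A' * lam₀ / 2 * (‖y - q‖ ^ 2 - e₀ ^ 2) := by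
  have hlampos : 0 < lam := hlam₀.trans_le hlam
  have hγ0 : 0 < γ := by rw [hγ]; positivity
  have hγ1 : γ ≤ 1 := by rw [hγ, div_le_one hlampos]; exact hlam
  have hγlam : γ * lam = lam₀ := by rw [hγ]; field_simp
  have hA'pos : 0 < A' := by rw [hA']; positivity
  set G := regSoftmax a μ c
  set g := smGrad a μ y + c • y with hg
  set B := A + γ * b' with hB
  have hBpos : 0 < B := by positivity
  set x' := ((1 - γ) * A / B) • x + (γ * A' / B) • y with hx'
  have hBx' : B • x' = ((1 - γ) * A) • x + (γ * A') • y := by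
    rw [hx', smul_add, smul_smul, smul_smul, mul_div_cancel₀ _ hBpos.ne',
      mul_div_cancel₀ _ hBpos.ne']
  have hBsum : B = (1 - γ) * A + γ * A' := by rw [hB, hA']; ring
  -- convexity at the new point
  have hconv : B * G x' ≤ (1 - γ) * A * G x + γ * A' * G y := by
    have h1 := mul_le_mul_of_nonneg_left (regSoftmax_tangent (a := a) hμ hc x x')
      (mul_nonneg (sub_nonneg.2 hγ1) hA.le)
    have h2 := mul_le_mul_of_nonneg_left (regSoftmax_tangent (a := a) hμ hc y x')
      (mul_nonneg hγ0.le hA'pos.le)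
    set g' := smGrad a μ x' + c • x'
    have h3 : (1 - γ) * A * ⟪g', x - x'⟫ + γ * A' * ⟪g', y - x'⟫ = 0 := by
      rw [← inner_smul_right, ← inner_smul_right, ← inner_add_right, smul_sub, smul_sub]
      have : ((1 - γ) * A) • x - ((1 - γ) * A) • x' + ((γ * A') • y - (γ * A') • x') = 0 := by
        have h4 : ((1 - γ) * A) • x' + (γ * A') • x' = B • x' := by rw [← add_smul, ← hBsum]
        rw [hBx'] at h4
        rw [sub_add_sub_comm, h4, sub_self]
      rw [this, inner_zero_right]
    have h5 : B * G x' = (1 - γ) * A * G x' + γ * A' * G x' := by rw [hBsum]; ring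
    linarith
  have hx := mul_le_mul_of_nonneg_left (regSoftmax_tangent (a := a) hμ hc x y)
    (mul_nonneg hγ0.le hA.le)
  have hv : ‖v - (γ * b') • g - u‖ ^ 2 = ‖v - u‖ ^ 2 - 2 * (γ * b' * ⟪g, v - u⟫) +
      (γ * b') ^ 2 * ‖g‖ ^ 2 := by
    have h1 : v - (γ * b') • g - u = (v - u) - (γ * b') • g := by abel
    rw [h1, norm_sub_sq_real, inner_smul_right, norm_smul, mul_pow, Real.norm_eq_abs, sq_abs,
      real_inner_comm]
  have hcollect : A * ⟪g, x - y⟫ + b' * ⟪g, v - u⟫ + b' * ⟪g, u - y⟫ = -(A' * ⟪g, y - q⟫) := by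
    have h1 := congrArg (fun w => ⟪g, w⟫) hq
    simp only [inner_add_right, inner_smul_right] at h1
    simp only [inner_sub_right]
    have h2 : A' * ⟪g, y⟫ = A * ⟪g, y⟫ + b' * ⟪g, y⟫ := by rw [hA']; ring
    linarith
  set ρ := g + lam • (y - q) with hρ
  have hgρ : g = ρ - lam • (y - q) := by rw [hρ]; abel
  have hgd : ⟪g, y - q⟫ = ⟪ρ, y - q⟫ - lam * ‖y - q‖ ^ 2 := by
    rw [hgρ, inner_sub_left, inner_smul_left, real_inner_self_eq_norm_sq, conj_trivial]
  have hg2 : ‖g‖ ^ 2 = ‖ρ‖ ^ 2 - 2 * (lam * ⟪ρ, y - q⟫) + lam ^ 2 * ‖y - q‖ ^ 2 := by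
    rw [hgρ, norm_sub_sq_real, inner_smul_right, norm_smul, mul_pow, Real.norm_eq_abs, sq_abs]
  have hb2 : (γ * b') ^ 2 * lam = γ * A' := by
    rw [← hstep, ← hγlam]; ring
  have hb2' : (γ * b') ^ 2 * lam ^ 2 = A' * lam₀ := by
    rw [← hγlam, show A' * (γ * lam) = (γ * A') * lam by ring, ← hb2]; ring
  have hρ2 : (γ * b') ^ 2 * ‖ρ‖ ^ 2 ≤ A' * lam₀ * e₀ ^ 2 := by
    have h1 : ‖ρ‖ ^ 2 ≤ (lam₀ * e₀) ^ 2 := by gcongr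
    have h2 : (lam₀ * e₀) ^ 2 ≤ (lam * e₀) ^ 2 := by
      rw [mul_pow, mul_pow]; gcongr
    calc (γ * b') ^ 2 * ‖ρ‖ ^ 2 ≤ (γ * b') ^ 2 * (lam * e₀) ^ 2 := by
          exact mul_le_mul_of_nonneg_left (h1.trans h2) (sq_nonneg _)
      _ = _ := by rw [← hb2']; ring
  have hfinal : γ * (A' * ⟪g, y - q⟫) + (γ * b') ^ 2 * ‖g‖ ^ 2 / 2 ≤
      -(A' * lam₀ / 2 * (‖y - q‖ ^ 2 - e₀ ^ 2)) := by
    have h1 : (γ * b') ^ 2 * ‖g‖ ^ 2 = (γ * b') ^ 2 * ‖ρ‖ ^ 2 -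
        2 * (γ * A' * ⟪ρ, y - q⟫) + A' * lam₀ * ‖y - q‖ ^ 2 := by
      rw [hg2, ← hb2, ← hb2']; ring
    have h2 : γ * (A' * ⟪g, y - q⟫) = γ * A' * ⟪ρ, y - q⟫ - A' * lam₀ * ‖y - q‖ ^ 2 := by
      rw [hgd, ← hγlam]; ring
    linarith
  have hcγ : γ * (A * ⟪g, x - y⟫ + b' * ⟪g, v - u⟫ + b' * ⟪g, u - y⟫) =
      γ * -(A' * ⟪g, y - q⟫) := by rw [hcollect]
  have hA'G : γ * A' * G y = γ * A * G y + γ * b' * G y := by rw [hA']; ring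
  rw [hv]
  nlinarith

end Acceleration

/-! ### The accelerated method for the regularized game -/

section Outer

variable {m n : ℕ}

lemma sum_add_smul_rows (A : Matrix (Fin m) (Fin n) ℝ) (y p : Fin m → ℝ) (b : ℝ) :
    ∑ i, (y + b • p) i • rows A i = ∑ i, y i • rows A i + b • ∑ i, p i • rows A i := by
  simp only [Pi.add_apply, Pi.smul_apply, smul_eq_mul, add_smul, mul_smul, sum_add_distrib,
    smul_sum]

variable [NeZero m]

/-- An approximate saddle point of the game with the regularizer `c / 2 ‖x‖ ^ 2`: the value at `x`
is bounded by the game against the mixed strategy `y`, up to the entropy and up to the slack `β`,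
and `x` is close to the regularized minimizer if that lies in the ball of radius `2`. -/
def IsRegSolution (A : Matrix (Fin m) (Fin n) ℝ) (μ c β : ℝ)
    (s : EuclideanSpace ℝ (Fin n) × (Fin m → ℝ)) : Prop :=
  s.2 ∈ stdSimplex ℝ (Fin m) ∧
    (∀ u, regSoftmax (rows A) μ c s.1 ≤ ⟪∑ i, s.2 i • rows A i, u⟫ +
      (μ * log m + c / 2 * ‖u‖ ^ 2) + β * (‖u‖ ^ 2 / 2 + ‖u‖ + 1 / 2)) ∧
    ∀ z, smGrad (rows A) μ z + c • z = 0 → ‖z‖ ≤ 2 → c * ‖s.1 - z‖ ^ 2 ≤ 10 * β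

/-- The state of the accelerated method: the accumulated weight, the two sequences of points, and
the accumulated Gibbs weights. -/
abbrev OuterState (m n : ℕ) : Type :=
  ℝ × EuclideanSpace ℝ (Fin n) × EuclideanSpace ℝ (Fin n) × (Fin m → ℝ)

/-- The invariant of the accelerated method after `t` steps, `f` of which were full steps and `d` of
which were damped: the full steps multiply the weight by `(1 - θ)⁻¹`, the damped steps decrease the
potential by `D`, and every step may increase it by the error `e`. -/
def OuterInv (A : Matrix (Fin m) (Fin n) ℝ) (μ c θ D e Abar : ℝ) (t : ℕ)
    (s : OuterState m n) : Prop :=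
  1 ≤ s.1 ∧ (∀ i, 0 ≤ s.2.2.2 i) ∧ ∑ i, s.2.2.2 i = s.1 ∧
    (∀ u, s.1 * regSoftmax (rows A) μ c s.2.1 + ‖s.2.2.1 - u‖ ^ 2 / 2 ≤
      ⟪∑ i, s.2.2.2 i • rows A i, u⟫ + s.1 * (μ * log m + c / 2 * ‖u‖ ^ 2) +
        (‖u‖ ^ 2 / 2 + ‖u‖ + t * e)) ∧
    ∃ f d : ℕ, (s.1 < Abar → f + d = t) ∧ 1 ≤ s.1 * (1 - θ) ^ f ∧
      ∀ u, s.1 * regSoftmax (rows A) μ c s.2.1 + ‖s.2.2.1 - u‖ ^ 2 / 2 + d * D ≤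
        s.1 * regSoftmax (rows A) μ c u + (‖u‖ ^ 2 / 2 + ‖u‖ + t * e)

lemma outerInv_zero {A : Matrix (Fin m) (Fin n) ℝ} (hA : twoToInftyNorm A ≤ 1) {μ c : ℝ}
    (hμ : 0 < μ) (hc : 0 ≤ c) (θ D e Abar : ℝ) :
    OuterInv A μ c θ D e Abar 0 (1, 0, 0, gibbs (rows A) μ 0) := by
  have ha := norm_rows_le hA
  have h1 : ∀ u, -‖u‖ ≤ ⟪smGrad (rows A) μ 0, u⟫ := fun u => by
    have h2 := (abs_le.1 (abs_real_inner_le_norm (smGrad (rows A) μ 0) u)).1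
    have h3 := mul_le_mul_of_nonneg_right (norm_smGrad_le (μ := μ) ha 0) (norm_nonneg u)
    linarith
  refine ⟨le_rfl, gibbs_nonneg 0, sum_gibbs 0, fun u => ?_, 0, 0, by simp, by simp, fun u => ?_⟩
  · have h2 := regSoftmax_tangent_le_entropy (a := rows A) hμ hc 0 u
    simp only [smul_zero, add_zero, sub_zero, Fintype.card_fin] at h2
    change 1 * _ + ‖0 - u‖ ^ 2 / 2 ≤ ⟪smGrad (rows A) μ 0, u⟫ + _ + _
    rw [zero_sub, norm_neg]
    push_cast
    linarith [h1 u]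
  · have h2 := regSoftmax_tangent (a := rows A) hμ hc u 0
    simp only [smul_zero, add_zero, sub_zero] at h2
    simp only [zero_sub, norm_neg]
    push_cast
    linarith [h1 u]

/-- While the minimizer of the regularized softmax lies in the ball of radius `2`, the invariant
bounds the number of damped steps and the distances from the minimizer. -/
lemma OuterInv.potential_le {A : Matrix (Fin m) (Fin n) ℝ} {μ c θ D e Abar : ℝ} (hμ : 0 < μ)
    {t : ℕ} (hte : t * e ≤ 1 / 2) {s : OuterState m n} (hs : OuterInv A μ c θ D e Abar t s)
    {z : EuclideanSpace ℝ (Fin n)} (hz : smGrad (rows A) μ z + c • z = 0) (hz2 : ‖z‖ ≤ 2) :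
    ∃ f d : ℕ, (s.1 < Abar → f + d = t) ∧ 1 ≤ s.1 * (1 - θ) ^ f ∧
      s.1 * (c / 2 * ‖s.2.1 - z‖ ^ 2) + ‖s.2.2.1 - z‖ ^ 2 / 2 + d * D ≤ 5 := by
  obtain ⟨h1, -, -, -, f, d, hfd, hf, hu⟩ := hs
  refine ⟨f, d, hfd, hf, ?_⟩
  have h2 := hu z
  have h3 := regSoftmax_strong_tangent (a := rows A) hμ c s.2.1 z
  rw [hz, inner_zero_left, add_zero] at h3
  have h4 := mul_le_mul_of_nonneg_left h3 (by linarith : 0 ≤ s.1)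
  have h5 : ‖z‖ ^ 2 ≤ 2 ^ 2 := by gcongr
  nlinarith

/-- One step of the accelerated method preserves the invariant. Here `K (1 - θ) / B` is the
planned proximal parameter, `b'` the undamped increase of the weight `B`, and `γ` the damping. By
`K θ ^ 2 = 1` this is the step size that `accelerated_step` asks for. -/
lemma OuterInv.step {A : Matrix (Fin m) (Fin n) ℝ} {μ c θ K r e₀ Abar : ℝ}
    (hμ : 0 < μ) (hc : 0 ≤ c) (hθ : 0 < θ) (hθ2 : θ ≤ 1 / 2) (hK : K * θ ^ 2 = 1) (hr : 0 ≤ r)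
    {t : ℕ} {B : ℝ} {x v : EuclideanSpace ℝ (Fin n)} {Y : Fin m → ℝ} (hB : B < Abar)
    (hs : OuterInv A μ c θ (K * r ^ 2 / 2) (K * e₀ ^ 2 / 2) Abar t (B, x, v, Y))
    {y : EuclideanSpace ℝ (Fin n)} {lam : ℝ} {p : Fin m → ℝ} {g : EuclideanSpace ℝ (Fin n)}
    (hp : IsProxStep A μ c (K * (1 - θ) / B) r e₀ ((1 - θ) • x + θ • v) (y, lam, p, g))
    {γ b' B' : ℝ} (hγ : γ = K * (1 - θ) / B / lam) (hb' : b' = θ * (B / (1 - θ)))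
    (hB' : B' = B / (1 - θ)) :
    OuterInv A μ c θ (K * r ^ 2 / 2) (K * e₀ ^ 2 / 2) Abar (t + 1)
      (B + γ * b', ((1 - γ) * B / (B + γ * b')) • x + (γ * B' / (B + γ * b')) • y,
        v - (γ * b') • (g + c • y), Y + (γ * b') • p) := by
  obtain ⟨h1, hY, hYs, hcert, f, d, hfd, hf, hpot⟩ := hs
  obtain ⟨hlam, hmove, hres, hpp, hgg⟩ := hp
  simp only at h1 hY hYs hcert hfd hf hpot hlam hmove hres hpp hgg
  have hθ1 : 0 < 1 - θ := by linarith
  have hBpos : 0 < B := by linarith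
  have hK0 : 0 < K := by
    by_contra! h
    nlinarith [sq_nonneg θ]
  set lam₀ := K * (1 - θ) / B with hlam₀
  have hlam₀pos : 0 < lam₀ := by positivity
  have hlampos : 0 < lam := hlam₀pos.trans_le hlam
  have hB'pos : 0 < B' := by rw [hB']; positivity
  have hb'eq : b' = θ * B' := by rw [hb', hB']
  have hb'pos : 0 < b' := by rw [hb'eq]; positivity
  have hBB' : B = (1 - θ) * B' := by rw [hB']; field_simp
  have hB'add : B' = B + b' := by rw [hBB', hb'eq]; ring
  have hKB : B' * lam₀ = K := by rw [hlam₀, hBB']; field_simp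
  have hstep : lam₀ * b' ^ 2 = B' := by
    rw [hb'eq]
    calc lam₀ * (θ * B') ^ 2 = B' * (B' * lam₀ * θ ^ 2) := by ring
      _ = B' := by rw [hKB, hK, mul_one]
  have hq : B' • ((1 - θ) • x + θ • v) = B • x + b' • v := by
    rw [smul_add, smul_smul, smul_smul, hBB', hb'eq, mul_comm B', mul_comm B']
  have hγ0 : 0 < γ := by rw [hγ]; positivity
  have hacc := accelerated_step (a := rows A) hμ hc hBpos hb'pos hB'add hlam₀pos hlam hstep hq
    hres hγ
  rw [hKB] at hacc
  set x' := ((1 - γ) * B / (B + γ * b')) • x + (γ * B' / (B + γ * b')) • y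
  have hb0 : 0 ≤ γ * b' := by positivity
  rw [← hgg] at hacc
  set q := (1 - θ) • x + θ • v
  have hp0 : ∀ i, 0 ≤ p i := fun i => by rw [hpp]; exact gibbs_nonneg y i
  have hp1 : ∑ i, p i = 1 := by rw [hpp]; exact sum_gibbs y
  have hd0 : 0 ≤ K / 2 * ‖y - q‖ ^ 2 := by positivity
  refine ⟨by simp only; linarith, fun i => ?_, ?_, fun u => ?_, ?_⟩
  · simp only [Pi.add_apply, Pi.smul_apply, smul_eq_mul]
    exact add_nonneg (hY i) (mul_nonneg hb0 (hp0 i))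
  · simp only [Pi.add_apply, Pi.smul_apply, smul_eq_mul, sum_add_distrib, ← mul_sum, hYs, hp1,
      mul_one]
  · have h2 := hacc u
    have h3 := mul_le_mul_of_nonneg_left
      (regSoftmax_tangent_le_entropy (a := rows A) hμ hc y u) hb0
    rw [← hgg, Fintype.card_fin] at h3
    have h4 := hcert u
    have h5 : ∑ i, p i • rows A i = g := by rw [hpp, hgg]; rfl
    simp only
    rw [sum_add_smul_rows, inner_add_left, inner_smul_left, h5, conj_trivial]
    push_cast
    linarith
  · have hmain : ∀ u, (B + γ * b') * regSoftmax (rows A) μ c x' +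
        ‖v - (γ * b') • (g + c • y) - u‖ ^ 2 / 2 + d * (K * r ^ 2 / 2) + K / 2 * ‖y - q‖ ^ 2 ≤
        (B + γ * b') * regSoftmax (rows A) μ c u +
          (‖u‖ ^ 2 / 2 + ‖u‖ + (t + 1 : ℕ) * (K * e₀ ^ 2 / 2)) := fun u => by
      have h2 := hacc u
      have h3 := mul_le_mul_of_nonneg_left (regSoftmax_tangent (a := rows A) hμ hc u y) hb0
      rw [← hgg] at h3
      have h4 := hpot u
      push_cast
      linarith
    rcases hmove with heq | hmove
    · have hγ1 : γ = 1 := by rw [hγ, heq, div_self hlam₀pos.ne']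
      refine ⟨f + 1, d, fun _ => by rw [← hfd hB]; ring, ?_, fun u => ?_⟩
      · simp only
        have : (B + γ * b') * (1 - θ) ^ (f + 1) = B * (1 - θ) ^ f := by
          rw [hγ1, one_mul, ← hB'add, pow_succ, mul_comm _ (1 - θ), ← mul_assoc, mul_comm B', ← hBB']
        rwa [this]
      · have := hmain u
        simp only
        linarith
    · refine ⟨f, d + 1, fun _ => by rw [← hfd hB]; ring, ?_, fun u => ?_⟩
      · refine hf.trans ?_
        simp only
        gcongr
        linarith
      · have h2 := hmain u
        have h3 : K / 2 * r ^ 2 ≤ K / 2 * ‖y - q‖ ^ 2 := by gcongr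
        simp only
        push_cast at h2 ⊢
        linarith

/-- The centres of the proximal steps stay in a ball of radius `Q`. -/
lemma OuterInv.norm_le {A : Matrix (Fin m) (Fin n) ℝ} {μ c θ D e Abar Q : ℝ} (hμ : 0 < μ)
    (hc : 0 < c) (hc1 : c ≤ 1) (hθ : 0 ≤ θ) (hθ1 : 0 ≤ 1 - θ) (hD : 0 ≤ D) (hQ2 : 2 ≤ Q)
    (hQ : 10 ≤ c * (Q - 2) ^ 2) {t : ℕ} (hte : t * e ≤ 1 / 2) {B : ℝ}
    {x v : EuclideanSpace ℝ (Fin n)} {Y : Fin m → ℝ}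
    (hinv : OuterInv A μ c θ D e Abar t (B, x, v, Y))
    (hPre : ∃ z, smGrad (rows A) μ z + c • z = 0 ∧ ‖z‖ ≤ 2) : ‖(1 - θ) • x + θ • v‖ ≤ Q := by
  have hB1 : 1 ≤ B := hinv.1
  obtain ⟨z, hz, hz2⟩ := hPre
  obtain ⟨f, d, -, -, hpot⟩ := hinv.potential_le hμ hte hz hz2
  simp only at hpot
  have hdD : 0 ≤ (d : ℝ) * D := by positivity
  have hQ' : 0 ≤ Q - 2 := by linarith
  have hv : ‖v - z‖ ≤ Q - 2 := by
    refine le_of_sq_le_sq ?_ hQ'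
    have h1 : 0 ≤ B * (c / 2 * ‖x - z‖ ^ 2) := by positivity
    have h2 : c * (Q - 2) ^ 2 ≤ 1 * (Q - 2) ^ 2 := by gcongr
    linarith
  have hx : ‖x - z‖ ≤ Q - 2 := by
    refine le_of_sq_le_sq ?_ hQ'
    have h1 : 1 * (c / 2 * ‖x - z‖ ^ 2) ≤ B * (c / 2 * ‖x - z‖ ^ 2) := by
      gcongr
    have h2 : 0 ≤ ‖v - z‖ ^ 2 / 2 := by positivity
    have h3 : c * ‖x - z‖ ^ 2 ≤ c * (Q - 2) ^ 2 := by linarith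
    exact le_of_mul_le_mul_left h3 hc
  have hdec : (1 - θ) • x + θ • v = (1 - θ) • (x - z) + θ • (v - z) + z := by
    module
  rw [hdec]
  refine (norm_add₃_le).trans ?_
  rw [norm_smul, norm_smul, Real.norm_of_nonneg hθ1, Real.norm_of_nonneg hθ]
  have h1 := mul_le_mul_of_nonneg_left hx hθ1
  have h2 := mul_le_mul_of_nonneg_left hv hθ
  linarith

/-- After `T` steps the weight exceeds `Abar`, since the bounded potential leaves room for at most
`10 / (K r ^ 2)` damped steps, and `log Abar / θ` full steps suffice. The accumulated Gibbs weights,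
normalized, are then the required mixed strategy. -/
lemma OuterInv.isRegSolution {A : Matrix (Fin m) (Fin n) ℝ} {μ c θ K r e Abar : ℝ} (hμ : 0 < μ)
    (hc : 0 < c) (hr0 : 0 < r) (hθ : 0 < θ) (hθ1 : 0 ≤ 1 - θ) (hK0 : 0 < K) (hAbar : 1 ≤ Abar)
    {T : ℕ} (hT : 10 / (K * r ^ 2) + log Abar / θ < T) (hte : T * e ≤ 1 / 2) {s : OuterState m n}
    (hinv : OuterInv A μ c θ (K * r ^ 2 / 2) e Abar T s)
    (hPre : ∃ z, smGrad (rows A) μ z + c • z = 0 ∧ ‖z‖ ≤ 2) :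
    IsRegSolution A μ c (1 / Abar) (s.2.1, fun i => s.2.2.2 i / s.1) := by
  obtain ⟨z₀, hz₀, hz₀2⟩ := hPre
  obtain ⟨f, d, hfd, hf, hpot⟩ := hinv.potential_le hμ hte hz₀ hz₀2
  have hs1 : 0 < s.1 := by linarith [hinv.1]
  have hbig : Abar ≤ s.1 := by
    by_contra! hlt
    have hd : (d : ℝ) ≤ 10 / (K * r ^ 2) := by
      rw [le_div_iff₀ (by positivity)]
      have h1 : 0 ≤ s.1 * (c / 2 * ‖s.2.1 - z₀‖ ^ 2) := by positivity
      have h2 : 0 ≤ ‖s.2.2.1 - z₀‖ ^ 2 / 2 := by positivity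
      linarith
    have hf' : (f : ℝ) ≤ log Abar / θ := by
      rw [le_div_iff₀ hθ]
      have h1 : (1 - θ) ^ f ≤ exp (-(f * θ)) := by
        rw [← mul_neg, exp_nat_mul]
        exact pow_le_pow_left₀ hθ1 (one_sub_le_exp_neg θ) f
      have h2 : 1 ≤ Abar * exp (-(f * θ)) := hf.trans (by gcongr)
      rw [exp_neg, ← div_eq_mul_inv, one_le_div (exp_pos _)] at h2
      exact (Real.le_log_iff_exp_le (by linarith)).2 h2
    have h3 : (f : ℝ) + d = T := by exact_mod_cast hfd hlt
    linarith
  have hβ : 1 / s.1 ≤ 1 / Abar := one_div_le_one_div_of_le (by linarith) hbig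
  have hinv₀ := hinv
  obtain ⟨h1, hY, hYs, hcert, -⟩ := hinv
  refine ⟨⟨fun i => div_nonneg (hY i) hs1.le, ?_⟩, fun u => ?_, fun z hz hz2 => ?_⟩
  · simp only
    rw [← sum_div, hYs, div_self hs1.ne']
  · have h2 := hcert u
    have h3 : ∑ i, (s.2.2.2 i / s.1) • rows A i = (1 / s.1) • ∑ i, s.2.2.2 i • rows A i := by
      rw [smul_sum]
      refine sum_congr rfl fun i _ => ?_
      rw [smul_smul, one_div_mul_eq_div]
    simp only
    rw [h3, inner_smul_left, conj_trivial]
    have h4 : s.1 * regSoftmax (rows A) μ c s.2.1 ≤ ⟪∑ i, s.2.2.2 i • rows A i, u⟫ +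
        s.1 * (μ * log m + c / 2 * ‖u‖ ^ 2) + (‖u‖ ^ 2 / 2 + ‖u‖ + 1 / 2) := by
      have h5 : 0 ≤ ‖s.2.2.1 - u‖ ^ 2 / 2 := by positivity
      linarith
    have h6 := mul_le_mul_of_nonneg_left h4 (one_div_pos.2 hs1).le
    have h7 : 1 / s.1 * (‖u‖ ^ 2 / 2 + ‖u‖ + 1 / 2) ≤
        1 / Abar * (‖u‖ ^ 2 / 2 + ‖u‖ + 1 / 2) := by gcongr
    rw [← mul_assoc, one_div_mul_cancel hs1.ne', one_mul, mul_add, mul_add, ← mul_assoc,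
      one_div_mul_cancel hs1.ne', one_mul] at h6
    linarith
  · obtain ⟨f', d', -, -, hpot'⟩ := OuterInv.potential_le hμ hte hinv₀ hz hz2
    have h2 : 0 ≤ ‖s.2.2.1 - z‖ ^ 2 / 2 := by positivity
    have h3 : 0 ≤ (d' : ℝ) * (K * r ^ 2 / 2) := by positivity
    have h4 : Abar * (c / 2 * ‖s.2.1 - z‖ ^ 2) ≤ s.1 * (c / 2 * ‖s.2.1 - z‖ ^ 2) := by gcongr
    simp only
    rw [mul_one_div, le_div_iff₀ (by linarith)]
    linarith

/-- The accelerated method with unspecified parameters: `k` and `j` belong to the Krylov spaces, `N`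
counts preconditioned gradient steps, `S` halvings of the proximal parameter and `T` accelerated
steps. The assumption that the regularized minimizer has norm at most `2` concerns the unknown
matrix, and is therefore part of the postcondition. -/
lemma solves_reg_game {μ c θ K r e₀ Abar Q lmin δ : ℝ} (hμ : 0 < μ) (hc : 0 < c) (hc1 : c ≤ 1)
    (hθ : 0 < θ) (hθ2 : θ ≤ 1 / 2) (hK : K * θ ^ 2 = 1) (hr0 : 0 < r) (hr : 27 * r ≤ μ)
    (he₀ : 0 ≤ e₀) (hAbar : 1 ≤ Abar) (hlmin : 0 < lmin) (hlmin' : lmin ≤ K / (2 * Abar))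
    (hQ2 : 2 ≤ Q) (hQ : 10 ≤ c * (Q - 2) ^ 2) {k j N S T : ℕ} (hk : 0 < k)
    (hδ : 2 * exp (-(j / √(1 + 1 / μ / (k * lmin)))) ≤ δ)
    (hδ' : 1024 * δ ^ 2 * (1 / μ + lmin) ≤ lmin)
    (hN : (63 / 64 : ℝ) ^ N * 25 ≤ 1)
    (hN' : 100 * (63 / 64 : ℝ) ^ N * (2 ^ S * K) * r ^ 2 * (1 / μ + 1 + 2 ^ S * K) ≤
      (lmin * e₀) ^ 2)
    (hS : 1 + Q ≤ 2 ^ S * lmin * r) (hS' : 1 / μ + 1 ≤ 2 ^ S * lmin)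
    (hT : 10 / (K * r ^ 2) + log Abar / θ < T) (hTe : T * (K * e₀ ^ 2) ≤ 1) :
    Solves (1 + T * ((S + 1) * (N * (2 + (k + j) * 2)) + 3))
      fun (A : Matrix (Fin m) (Fin n) ℝ) s =>
        (∃ z, smGrad (rows A) μ z + c • z = 0 ∧ ‖z‖ ≤ 2) → IsRegSolution A μ c (1 / Abar) s := by
  have hθ1 : 0 < 1 - θ := by linarith
  have hK0 : 0 < K := by
    by_contra! h
    nlinarith [sq_nonneg θ]
  have hK1 : 1 ≤ K := by nlinarith [mul_pos hK0 hθ]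
  have hte : ∀ t : ℕ, t ≤ T → (t : ℝ) * (K * e₀ ^ 2 / 2) ≤ 1 / 2 := fun t ht => by
    have h1 : (t : ℝ) ≤ T := by exact_mod_cast ht
    have h2 : (t : ℝ) * (K * e₀ ^ 2) ≤ T * (K * e₀ ^ 2) := by gcongr
    linarith
  let Pre : Matrix (Fin m) (Fin n) ℝ → Prop := fun A =>
    ∃ z, smGrad (rows A) μ z + c • z = 0 ∧ ‖z‖ ≤ 2
  have hstep : ∀ t, t < T → ∀ s : OuterState m n,
      Solves ((S + 1) * (N * (2 + (k + j) * 2)) + 3) fun (A : Matrix (Fin m) (Fin n) ℝ) s' =>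
        (Pre A → OuterInv A μ c θ (K * r ^ 2 / 2) (K * e₀ ^ 2 / 2) Abar t s) →
        (Pre A → OuterInv A μ c θ (K * r ^ 2 / 2) (K * e₀ ^ 2 / 2) Abar (t + 1) s') := by
    rintro t ht ⟨B, x, v, Y⟩
    by_cases hB : B < Abar
    swap
    · refine Solves.pure (B, x, v, Y) (fun A _ h hPre => ?_) _
      obtain ⟨h1, h2, h3, h4, f, d, h5, h6, h7⟩ := h hPre
      have hKe : 0 ≤ K * e₀ ^ 2 / 2 := by positivity
      refine ⟨h1, h2, h3, fun u => ?_, f, d, fun h => absurd h hB, h6, fun u => ?_⟩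
      · have := h4 u
        push_cast
        linarith
      · have := h7 u
        push_cast
        linarith
    by_cases hB1 : 1 ≤ B
    swap
    · exact Solves.pure (B, x, v, Y) (fun A _ h hPre => absurd (h hPre).1 hB1) _
    set lam₀ := K * (1 - θ) / B with hlam₀
    have hlam₀min : lmin ≤ lam₀ := by
      refine hlmin'.trans ?_
      rw [hlam₀, div_le_div_iff₀ (by linarith) (by linarith)]
      have h1 : K * B ≤ K * Abar := by gcongr
      have h2 : K * Abar * 1 ≤ K * Abar * (2 * (1 - θ)) := by gcongr; linarith
      linarith
    have hlam₀pos : 0 < lam₀ := hlmin.trans_le hlam₀min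
    have hlam₀K : lam₀ ≤ K := by
      rw [hlam₀, div_le_iff₀ (by linarith)]
      have h2 : K * (1 - θ) ≤ K * 1 := by gcongr; linarith
      have h3 : K * 1 ≤ K * B := by gcongr
      linarith
    have hk' : (0 : ℝ) < k := by exact_mod_cast hk
    have hδ0 : 0 ≤ δ := le_trans (by positivity) hδ
    have hprox := solves_prox (m := m) (n := n) (μ := μ) (c := c) (lam₀ := lam₀) (r := r) (δ := δ)
      (e₀ := e₀) (Q := Q) hμ hc.le hc1 hlam₀pos hr0 hr he₀ (j := j) hk
      (le_trans (by gcongr) hδ)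
      (by
        have h1 : 1024 * δ ^ 2 ≤ 1 := by
          have : 0 < 1 / μ := by positivity
          by_contra! h
          nlinarith
        nlinarith)
      hN
      (le_trans (by gcongr) (hN'.trans (by gcongr)))
      (hS.trans (by gcongr)) (hS'.trans (by gcongr))
      ((1 - θ) • x + θ • v)
    refine hprox.bind (N' := 0) fun s => Solves.pure
      (B + lam₀ / s.2.1 * (θ * (B / (1 - θ))),
        ((1 - lam₀ / s.2.1) * B / (B + lam₀ / s.2.1 * (θ * (B / (1 - θ))))) • x +
          (lam₀ / s.2.1 * (B / (1 - θ)) / (B + lam₀ / s.2.1 * (θ * (B / (1 - θ))))) • s.1,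
        v - (lam₀ / s.2.1 * (θ * (B / (1 - θ)))) • (s.2.2.2 + c • s.1),
        Y + (lam₀ / s.2.1 * (θ * (B / (1 - θ)))) • s.2.2.1) (fun A hA hs h hPre => ?_) 0
    have hinv := h hPre
    refine hinv.step hμ hc.le hθ hθ2 hK hr0.le hB (y := s.1) (lam := s.2.1) (p := s.2.2.1)
      (g := s.2.2.2) (hs ?_) rfl rfl rfl
    exact hinv.norm_le hμ hc hc1 hθ.le hθ1.le (by positivity) hQ2 hQ (hte t ht.le) hPre
  refine (solves_gibbs μ 0).bind fun p₀ => ?_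
  rw [← Nat.add_zero (T * _)]
  refine (Solves.iterate (fun t A s => Pre A →
    OuterInv A μ c θ (K * r ^ 2 / 2) (K * e₀ ^ 2 / 2) Abar t s) T hstep (1, 0, 0, p₀)).bind
    fun s => Solves.pure (s.2.1, fun i => s.2.2.2 i / s.1) (fun A hA hs hp₀ hPre => ?_) 0
  have hinv := hs (fun _ => by rw [hp₀]; exact outerInv_zero hA hμ hc.le _ _ _ _) hPre
  exact hinv.isRegSolution hμ hc hr0 hθ hθ1.le hK0 hAbar hT (hte T le_rfl) hPre

end Outer

/-! ### From regularized games to the game on the ball -/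

section Game

variable {m n : ℕ}

lemma bilin_eq_sum (A : Matrix (Fin m) (Fin n) ℝ) (x : EuclideanSpace ℝ (Fin n)) (y : Fin m → ℝ) :
    bilin A x.ofLp y = ∑ i, y i * ⟪rows A i, x⟫ := by
  simp only [bilin, dotProduct, inner_rows]

lemma bilin_eq_inner (A : Matrix (Fin m) (Fin n) ℝ) (x : EuclideanSpace ℝ (Fin n)) (y : Fin m → ℝ) :
    bilin A x.ofLp y = ⟪∑ i, y i • rows A i, x⟫ := by
  simp only [bilin_eq_sum, sum_inner, inner_smul_left, conj_trivial]

/-- The linear optimization over the ball in the definition of the gap is explicit. -/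
lemma isEpsSolution_of_forall_le {A : Matrix (Fin m) (Fin n) ℝ} {ε : ℝ}
    {x : EuclideanSpace ℝ (Fin n)} {y : Fin m → ℝ} (hx : ‖x‖ ≤ 1) (hy : y ∈ stdSimplex ℝ (Fin m))
    (h : ∀ i, ⟪rows A i, x⟫ + ‖∑ i, y i • rows A i‖ ≤ ε) :
    IsEpsSolution (unitBall n) (stdSimplex ℝ (Fin m)) (bilin A) ε (x.ofLp, y) := by
  refine ⟨hx, hy, ?_⟩
  set S := ∑ i, y i • rows A i
  have h1 : sSup ((fun y' => bilin A x.ofLp y') '' stdSimplex ℝ (Fin m)) ≤ ε - ‖S‖ := by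
    refine csSup_le ⟨_, y, hy, rfl⟩ ?_
    rintro _ ⟨y', hy', rfl⟩
    simp only
    rw [bilin_eq_sum]
    calc ∑ i, y' i * ⟪rows A i, x⟫ ≤ ∑ i, y' i * (ε - ‖S‖) :=
          sum_le_sum fun i _ => mul_le_mul_of_nonneg_left (by linarith [h i]) (hy'.1 i)
      _ = ε - ‖S‖ := by rw [← sum_mul, hy'.2, one_mul]
  have h2 : -‖S‖ ≤ sInf ((fun x' => bilin A x' y) '' unitBall n) := by
    refine le_csInf ⟨_, x.ofLp, hx, rfl⟩ ?_
    rintro _ ⟨x', hx', rfl⟩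
    have hx'1 : ‖WithLp.toLp 2 x'‖ ≤ 1 := hx'
    have h3 : bilin A x' y = ⟪S, WithLp.toLp 2 x'⟫ := bilin_eq_inner A (WithLp.toLp 2 x') y
    simp only
    rw [h3]
    have h4 := (abs_le.1 (abs_real_inner_le_norm S (WithLp.toLp 2 x'))).1
    have h5 := mul_le_mul_of_nonneg_left hx'1 (norm_nonneg S)
    linarith
  unfold gap
  simp only
  linarith

lemma exists_inner_eq_neg {E : Type*} [NormedAddCommGroup E] [InnerProductSpace ℝ E] (S : E)
    {ρ : ℝ} (hρ : 0 ≤ ρ) : ∃ u : E, ‖u‖ ≤ ρ ∧ ⟪S, u⟫ = -(ρ * ‖S‖) := by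
  rcases eq_or_ne S 0 with rfl | hS
  · exact ⟨0, by simpa using hρ, by simp⟩
  · have hS' : 0 < ‖S‖ := norm_pos_iff.2 hS
    refine ⟨-(ρ / ‖S‖) • S, ?_, ?_⟩
    · rw [norm_smul, norm_neg, Real.norm_of_nonneg (by positivity), div_mul_cancel₀ _ hS'.ne']
    · rw [inner_smul_right, real_inner_self_eq_norm_sq]
      field_simp

lemma IsRegSolution.le_of_norm_le {A : Matrix (Fin m) (Fin n) ℝ} {μ c β : ℝ} (hc : 0 ≤ c)
    (hβ : 0 ≤ β) {x : EuclideanSpace ℝ (Fin n)} {y : Fin m → ℝ} (h : IsRegSolution A μ c β (x, y))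
    {ρ : ℝ} (hρ : 0 ≤ ρ) :
    regSoftmax (rows A) μ c x + ρ * ‖∑ i, y i • rows A i‖ ≤
      μ * log m + c / 2 * ρ ^ 2 + β * (ρ ^ 2 / 2 + ρ + 1 / 2) := by
  obtain ⟨u, hu, hSu⟩ := exists_inner_eq_neg (∑ i, y i • rows A i) hρ
  have h1 := h.2.1 u
  simp only [hSu] at h1
  have h2 : c / 2 * ‖u‖ ^ 2 ≤ c / 2 * ρ ^ 2 := by gcongr
  have h3 : β * (‖u‖ ^ 2 / 2 + ‖u‖ + 1 / 2) ≤ β * (ρ ^ 2 / 2 + ρ + 1 / 2) := by gcongr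
  linarith

variable [NeZero m]

/-- A regularized solution `x` that is not small can be normalized. -/
lemma IsRegSolution.forall_le_of_half_le {A : Matrix (Fin m) (Fin n) ℝ} {μ c β ε : ℝ} (hμ : 0 < μ)
    (hε : 0 < ε) (hc : ε / 8 ≤ c) (hβ : 0 ≤ β) (hβε : β ≤ ε / 160) (hμm : μ * log m ≤ ε / 8)
    {x : EuclideanSpace ℝ (Fin n)} {y : Fin m → ℝ} (h : IsRegSolution A μ c β (x, y))
    (hpre : ∃ z, smGrad (rows A) μ z + c • z = 0 ∧ ‖z‖ ≤ 2) (hx : 1 / 2 ≤ ‖x‖) (i : Fin m) :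
    ⟪rows A i, (1 / ‖x‖) • x⟫ + ‖∑ i, y i • rows A i‖ ≤ ε := by
  have hcpos : 0 < c := by linarith
  obtain ⟨z, hz, hz2⟩ := hpre
  have hx3 : ‖x‖ ≤ 3 := by
    have h1 := h.2.2 z hz hz2
    simp only at h1
    have h2 : c * ‖x - z‖ ^ 2 ≤ c * 1 ^ 2 := by nlinarith
    have h3 := le_of_sq_le_sq (le_of_mul_le_mul_left h2 hcpos) zero_le_one
    have h4 : x = (x - z) + z := by abel
    rw [h4]
    exact (norm_add_le _ _).trans (by linarith)
  set ρ := ‖x‖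
  set S := ∑ i, y i • rows A i
  have hρ : 0 < ρ := by linarith
  have h1 : softmax (rows A) μ x + c / 2 * ρ ^ 2 + ρ * ‖S‖ ≤
      μ * log m + c / 2 * ρ ^ 2 + β * (ρ ^ 2 / 2 + ρ + 1 / 2) :=
    h.le_of_norm_le hcpos.le hβ hρ.le
  have h2 := inner_le_softmax (a := rows A) hμ x i
  have h3 : ρ * (⟪rows A i, (1 / ρ) • x⟫ + ‖S‖) ≤ ρ * ε := by
    rw [inner_smul_right, mul_add, ← mul_assoc, mul_one_div_cancel hρ.ne', one_mul]
    have h4 : β * (ρ ^ 2 / 2 + ρ + 1 / 2) ≤ ε / 160 * (ρ ^ 2 / 2 + ρ + 1 / 2) := by gcongr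
    have h5 : ε * ρ ^ 2 ≤ ε * (3 * ρ) := by
      rw [sq]; gcongr
    have h6 : ε * (1 / 2) ≤ ε * ρ := by gcongr
    linarith
  exact le_of_mul_le_mul_left h3 hρ

/-- If the regularizer is weak and the regularized solution `x` is small, then `0` is as good. -/
lemma IsRegSolution.norm_le_of_lt_half {A : Matrix (Fin m) (Fin n) ℝ} {μ c β ε : ℝ} (hμ : 0 < μ)
    (hε : 0 < ε) (hc : 0 ≤ c) (hc' : c ≤ ε / 4) (hβ : 0 ≤ β) (hβε : β ≤ ε / 160)
    (hμm : μ * log m ≤ ε / 8) {x : EuclideanSpace ℝ (Fin n)} {y : Fin m → ℝ}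
    (h : IsRegSolution A μ c β (x, y)) (hx : ‖x‖ < 1 / 2) :
    ‖∑ i, y i • rows A i‖ ≤ ε := by
  have h1 := h.le_of_norm_le hc hβ zero_le_one
  set S := ∑ i, y i • rows A i with hS
  have h2 : ⟪S, x⟫ ≤ softmax (rows A) μ x := by
    rw [hS, sum_inner]
    calc ∑ i, ⟪y i • rows A i, x⟫ ≤ ∑ i, y i * softmax (rows A) μ x := by
          refine sum_le_sum fun i _ => ?_
          rw [inner_smul_left, conj_trivial]
          exact mul_le_mul_of_nonneg_left (inner_le_softmax hμ x i) (h.1.1 i)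
      _ = softmax (rows A) μ x := by
          have := h.1.2
          simp only at this
          rw [← sum_mul, this, one_mul]
  have h3 := (abs_le.1 (abs_real_inner_le_norm S x)).1
  have h4 := mul_le_mul_of_nonneg_left hx.le (norm_nonneg S)
  have h5 : 0 ≤ c / 2 * ‖x‖ ^ 2 := by positivity
  rw [regSoftmax] at h1
  linarith

/-- Halving the regularizer at most doubles the norm of the regularized minimizer. -/
lemma norm_le_two_mul_of_halved {a : Fin m → EuclideanSpace ℝ (Fin n)} {μ c : ℝ} (hμ : 0 < μ)
    (hc : 0 < c) {z z' : EuclideanSpace ℝ (Fin n)} (hz : smGrad a μ z + c • z = 0)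
    (hz' : smGrad a μ z' + (c / 2) • z' = 0) : ‖z'‖ ≤ 2 * ‖z‖ := by
  have h1 := inner_smGrad_sub_nonneg (a := a) hμ z' z
  rw [eq_neg_of_add_eq_zero_left hz, eq_neg_of_add_eq_zero_left hz'] at h1
  simp only [inner_sub_left, inner_sub_right, inner_neg_left, inner_smul_left, conj_trivial,
    real_inner_self_eq_norm_sq] at h1
  rw [real_inner_comm z z'] at h1
  have h2 := real_inner_le_norm z z'
  have h3 : 0 ≤ c * (3 * ⟪z, z'⟫ - 2 * ‖z‖ ^ 2 - ‖z'‖ ^ 2) := by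
    linarith
  have h4 := nonneg_of_mul_nonneg_right h3 hc
  by_contra! h5
  nlinarith [norm_nonneg z, mul_pos (by linarith [norm_nonneg z] : 0 < ‖z'‖ - ‖z‖)
    (by linarith : 0 < ‖z'‖ - 2 * ‖z‖)]

/-- The game is solved by running the accelerated method with the regularizers `1, 1/2, 1/4, …`
until the solution leaves the ball of radius `1/2` or the regularizer becomes negligible. Up to
that point the regularized minimizers stay in the ball of radius `2`. -/
lemma solves_game {μ β ε : ℝ} (hμ : 0 < μ) (hε : 0 < ε) (hβ : 0 ≤ β)
    (hβε : β ≤ ε / 160) (hμm : μ * log m ≤ ε / 8) {J N : ℕ} (hJ : 4 / ε ≤ 2 ^ J)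
    (hJ' : 2 ^ J ≤ 8 / ε)
    (hrun : ∀ c, ε / 8 ≤ c → c ≤ 1 → Solves N fun (A : Matrix (Fin m) (Fin n) ℝ) s =>
      (∃ z, smGrad (rows A) μ z + c • z = 0 ∧ ‖z‖ ≤ 2) → IsRegSolution A μ c β s) :
    Solves ((J + 1) * (N + 2)) fun (A : Matrix (Fin m) (Fin n) ℝ) z =>
      IsEpsSolution (unitBall n) (stdSimplex ℝ (Fin m)) (bilin A) ε z := by
  let I : ℕ → Matrix (Fin m) (Fin n) ℝ → Option ((Fin n → ℝ) × (Fin m → ℝ)) → Prop :=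
    fun t A s => (∃ z, s = some z ∧
        IsEpsSolution (unitBall n) (stdSimplex ℝ (Fin m)) (bilin A) ε z) ∨
      (s = none ∧ t ≤ J ∧ ∃ z, smGrad (rows A) μ z + ((1 : ℝ) / 2 ^ t) • z = 0 ∧ ‖z‖ ≤ 2)
  have hcJ : (1 : ℝ) / 2 ^ J ≤ ε / 4 := by
    rw [div_le_iff₀ (by positivity)]
    rw [div_le_iff₀ hε] at hJ
    linarith
  have hstep : ∀ t, t < J + 1 → ∀ s, Solves (N + 2) fun A s' => I t A s → I (t + 1) A s' := by
    intro t ht s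
    rcases s with _ | z₀
    swap
    · refine Solves.pure (some z₀) (fun A _ h => ?_) _
      rcases h with ⟨z, hz, hsol⟩ | ⟨h, -⟩
      · exact Or.inl ⟨z, hz, hsol⟩
      · cases h
    set c : ℝ := 1 / 2 ^ t with hc
    have hcpos : 0 < c := by positivity
    have hc1 : c ≤ 1 := by
      rw [hc, div_le_one (by positivity)]
      exact one_le_pow₀ (by norm_num)
    have hc8 : ε / 8 ≤ c := by
      have h1 : (2 : ℝ) ^ t ≤ 8 / ε :=
        (pow_le_pow_right₀ (by norm_num) (Nat.lt_succ_iff.1 ht)).trans hJ'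
      rw [hc, le_div_iff₀ (by positivity)]
      rw [le_div_iff₀ hε] at h1
      linarith
    have hc4 : t < J → ε / 4 ≤ c := fun htJ => by
      have h1 : (2 : ℝ) ^ (t + 1) ≤ 8 / ε := (pow_le_pow_right₀ (by norm_num) htJ).trans hJ'
      rw [pow_succ] at h1
      rw [hc, le_div_iff₀ (by positivity)]
      rw [le_div_iff₀ hε] at h1
      linarith
    -- run the accelerated method, normalize its answer, and check the gap of the result
    refine (hrun c hc8 hc1).bind fun s => ?_
    set x' : EuclideanSpace ℝ (Fin n) := if 1 / 2 ≤ ‖s.1‖ then (1 / ‖s.1‖) • s.1 else 0 with hx'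
    have hx'1 : ‖x'‖ ≤ 1 := by
      rw [hx']
      split_ifs with h
      · rw [norm_smul, Real.norm_of_nonneg (by positivity), one_div_mul_cancel (by linarith)]
      · simp
    refine Solves.bind (N := 1) (N' := 1) (solves_inner_rows x') fun b =>
      Solves.bind (N := 1) (N' := 0) (solves_sum_smul_rows s.2) fun S => ?_
    by_cases hgood : s.2 ∈ stdSimplex ℝ (Fin m) ∧ ∀ i, b i + ‖S‖ ≤ ε
    · refine Solves.pure (some (x'.ofLp, s.2)) (fun A _ hS hb _ _ => Or.inl ⟨_, rfl, ?_⟩) 0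
      subst hb hS
      exact isEpsSolution_of_forall_le hx'1 hgood.1 hgood.2
    · refine Solves.pure none (fun A hA hS hb hs hI => Or.inr ?_) 0
      subst hb hS
      rcases hI with ⟨_, h, -⟩ | ⟨-, -, hpre⟩
      · cases h
      have hsol : IsRegSolution A μ c β (s.1, s.2) := hs hpre
      have hsmall : ‖s.1‖ < 1 / 2 := by
        by_contra! hlarge
        refine hgood ⟨hsol.1, fun i => ?_⟩
        simp only [hx', if_pos hlarge]
        exact hsol.forall_le_of_half_le hμ hε hc8 hβ hβε hμm hpre hlarge i
      have htJ : t < J := by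
        refine lt_of_le_of_ne (Nat.lt_succ_iff.1 ht) fun htJ => ?_
        refine hgood ⟨hsol.1, fun i => ?_⟩
        simp only [hx', if_neg (not_le.2 hsmall), inner_zero_right, zero_add]
        refine hsol.norm_le_of_lt_half hμ hε hcpos.le ?_ hβ hβε hμm hsmall
        rw [hc, htJ]
        exact hcJ
      refine ⟨rfl, htJ, ?_⟩
      have hhalf : (1 : ℝ) / 2 ^ (t + 1) = c / 2 := by rw [hc, pow_succ]; field_simp
      obtain ⟨z, hz, hz2⟩ := hpre
      obtain ⟨z', hz'⟩ := exists_smGrad_add_smul_eq_zero (a := rows A) hμ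
        (by linarith : 0 < c / 2) 0
      rw [sub_zero] at hz'
      rw [hhalf]
      refine ⟨z', hz', (norm_le_two_mul_of_halved hμ hcpos hz hz').trans ?_⟩
      have h1 := hsol.2.2 z hz hz2
      simp only at h1
      have h2 : c * ‖s.1 - z‖ ^ 2 ≤ c * (1 / 2) ^ 2 := by nlinarith [hc4 htJ]
      have h3 := le_of_sq_le_sq (le_of_mul_le_mul_left h2 hcpos) (by norm_num)
      have h4 : z = s.1 - (s.1 - z) := by abel
      have h5 : ‖z‖ ≤ ‖s.1‖ + ‖s.1 - z‖ := by
        conv_lhs => rw [h4]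
        exact norm_sub_le _ _
      linarith
  rw [← Nat.add_zero ((J + 1) * (N + 2))]
  refine (Solves.iterate I (J + 1) hstep none).bind fun s => ?_
  rcases s with _ | z
  · -- the loop cannot end without a solution
    refine Solves.pure 0 (fun A hA h => ?_) 0
    obtain ⟨z, hz⟩ := exists_smGrad_add_smul_eq_zero (a := rows A) hμ zero_lt_one 0
    have hz1 : ‖z‖ ≤ 2 := by
      rw [sub_zero, one_smul] at hz
      rw [eq_neg_of_add_eq_zero_right hz, norm_neg]
      exact (norm_smGrad_le (norm_rows_le hA) z).trans (by norm_num)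
    rcases h (Or.inr ⟨rfl, Nat.zero_le _, z, by simpa using hz, hz1⟩) with ⟨_, h, -⟩ | ⟨-, h, -⟩
    · cases h
    · omega
  · refine Solves.pure z (fun A hA h => ?_) 0
    obtain ⟨z₁, hz₁⟩ := exists_smGrad_add_smul_eq_zero (a := rows A) hμ zero_lt_one 0
    have hz1 : ‖z₁‖ ≤ 2 := by
      rw [sub_zero, one_smul] at hz₁
      rw [eq_neg_of_add_eq_zero_right hz₁, norm_neg]
      exact (norm_smGrad_le (norm_rows_le hA) z₁).trans (by norm_num)
    rcases h (Or.inr ⟨rfl, Nat.zero_le _, z₁, by simpa using hz₁, hz1⟩) with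
      ⟨_, h, hsol⟩ | ⟨h, -⟩
    · cases h
      exact hsol
    · cases h

end Game

/-! ### The choice of the parameters -/

section Parameters

lemma exists_two_pow_near {ε : ℝ} (hε : 0 < ε) (hε4 : ε ≤ 4) :
    ∃ J : ℕ, 4 / ε ≤ 2 ^ J ∧ (2 : ℝ) ^ J ≤ 8 / ε := by
  obtain ⟨N, h1, h2⟩ := exists_nat_pow_near (x := 4 / ε) (y := (2 : ℝ))
    (by rwa [one_le_div hε]) (by norm_num)
  refine ⟨N + 1, h2.le, ?_⟩
  rw [pow_succ]
  calc (2 : ℝ) ^ N * 2 ≤ 4 / ε * 2 := by gcongr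
    _ = 8 / ε := by ring

lemma ceil_le_mul {x a b : ℝ} (hx : 0 ≤ x) (h : x + 1 ≤ a * b) : (⌈x⌉₊ : ℝ) ≤ a * b :=
  (Nat.ceil_lt_add_one hx).le.trans h

lemma two_pow_eq_exp (a : ℕ) : (2 : ℝ) ^ a = exp (a * log 2) := by
  rw [exp_nat_mul, exp_log two_pos]

/-- With `ℓ = log X` this says `X ^ b ≤ 2 ^ S` for a number `S` of order `b log X`; it serves to
choose numbers of iterations. -/
lemma le_two_pow_ceil (b : ℕ) (ℓ : ℝ) :
    exp (b * ℓ) ≤ (2 : ℝ) ^ ⌈((2 * b : ℕ) : ℝ) * ℓ⌉₊ := by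
  rw [two_pow_eq_exp]
  apply exp_le_exp.2
  have h1 : ((2 * b : ℕ) : ℝ) * ℓ ≤ ⌈((2 * b : ℕ) : ℝ) * ℓ⌉₊ := Nat.le_ceil _
  have h2 : (1 : ℝ) / 2 ≤ log 2 := by linarith [Real.log_two_gt_d9]
  calc (b : ℝ) * ℓ = ((2 * b : ℕ) : ℝ) * ℓ * (1 / 2) := by push_cast; ring
    _ ≤ _ := by gcongr

lemma two_pow_ceil_le {ℓ : ℝ} (b : ℕ) (hℓ : 1 ≤ ℓ) :
    (2 : ℝ) ^ ⌈((2 * b : ℕ) : ℝ) * ℓ⌉₊ ≤ exp ((2 * b + 1 : ℕ) * ℓ) := by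
  rw [two_pow_eq_exp]
  apply exp_le_exp.2
  have h1 := Nat.ceil_lt_add_one (a := ((2 * b : ℕ) : ℝ) * ℓ) (by positivity)
  have h2 : (⌈((2 * b : ℕ) : ℝ) * ℓ⌉₊ : ℝ) * log 2 ≤ ⌈((2 * b : ℕ) : ℝ) * ℓ⌉₊ * 1 := by
    gcongr
    linarith [Real.log_two_lt_d9]
  push_cast at *
  linarith

lemma pow_ceil_mul_exp_le_one (b : ℕ) (ℓ : ℝ) :
    (63 / 64 : ℝ) ^ ⌈((64 * b : ℕ) : ℝ) * ℓ⌉₊ * exp (b * ℓ) ≤ 1 := by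
  have h1 : (63 / 64 : ℝ) ≤ exp (-(1 / 64)) := by
    have := Real.one_sub_le_exp_neg (1 / 64)
    linarith
  calc (63 / 64 : ℝ) ^ ⌈((64 * b : ℕ) : ℝ) * ℓ⌉₊ * exp (b * ℓ)
      ≤ exp (-(1 / 64)) ^ ⌈((64 * b : ℕ) : ℝ) * ℓ⌉₊ * exp (b * ℓ) := by gcongr
    _ = exp (⌈((64 * b : ℕ) : ℝ) * ℓ⌉₊ * (-(1 / 64)) + b * ℓ) := by
        rw [← exp_nat_mul, exp_add]
    _ ≤ 1 := by
        rw [exp_le_one_iff]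
        have h3 : ((64 * b : ℕ) : ℝ) * ℓ ≤ ⌈((64 * b : ℕ) : ℝ) * ℓ⌉₊ := Nat.le_ceil _
        push_cast at *
        linarith

variable {m n : ℕ} [NeZero m]

set_option maxHeartbeats 1000000 in
/-- The accelerated method with concrete parameters. Here `X` bounds all quantities that enter only
through their logarithm `ℓ`. The factors of the number of queries are the accelerated steps, the
proximal parameters per step, the gradient steps per parameter, and the queries per gradient step:
two for the gradient, and two for each dimension of the Krylov space. -/
lemma solves_reg_game_param {ε X ℓ : ℝ} (hε : 0 < ε) (hε8 : ε ≤ 1 / 8) (hX : 11 ≤ X)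
    (hRX : 1 / ε ≤ X) (hℓ : ℓ = log X) (hℓ2 : 2 ≤ ℓ) {c : ℝ} (hc : ε / 8 ≤ c) (hc1 : c ≤ 1) :
    Solves (1 + ⌈500000 * ℓ ^ 2 * ε ^ (-(2 / 3) : ℝ)⌉₊ *
        ((⌈22 * ℓ⌉₊ + 1) * (⌈4416 * ℓ⌉₊ *
          (2 + (⌈ε ^ (-(2 / 9) : ℝ)⌉₊ + ⌈306 * ℓ ^ 2 * ε ^ (-(2 / 9) : ℝ)⌉₊) * 2)) + 3))
      fun (A : Matrix (Fin m) (Fin n) ℝ) s =>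
        (∃ z, smGrad (rows A) (ε / (8 * ℓ)) z + c • z = 0 ∧ ‖z‖ ≤ 2) →
          IsRegSolution A (ε / (8 * ℓ)) c (1 / (160 / ε)) s := by
  have hℓpos : 0 < ℓ := by linarith
  have hXpos : 0 < X := by linarith
  have hX1 : 1 ≤ X := by linarith
  have hℓX : ℓ ≤ X := by rw [hℓ]; exact (Real.log_le_sub_one_of_pos hXpos).trans (by linarith)
  have hexp : ∀ a : ℕ, exp (a * ℓ) = X ^ a := fun a => by
    rw [exp_nat_mul, hℓ, exp_log hXpos]
  have hX2 : 121 ≤ X ^ 2 := le_trans (by norm_num) (pow_le_pow_left₀ (by norm_num) hX 2)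
  have hX3 : 1331 ≤ X ^ 3 := le_trans (by norm_num) (pow_le_pow_left₀ (by norm_num) hX 3)
  have hX4 : 14641 ≤ X ^ 4 := le_trans (by norm_num) (pow_le_pow_left₀ (by norm_num) hX 4)
  have hmono : ∀ {a b : ℕ}, a ≤ b → X ^ a ≤ X ^ b := fun h => pow_le_pow_right₀ hX1 h
  -- the powers of `ε` that occur
  set w : ℝ := ε ^ (-(2 / 9) : ℝ) with hw
  set K : ℝ := ε ^ (-(4 / 3) : ℝ) with hK
  set θ : ℝ := ε ^ (2 / 3 : ℝ) with hθ
  set t : ℝ := ε ^ (-(2 / 3) : ℝ) with ht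
  have hwpos : 0 < w := rpow_pos_of_pos hε _
  have hKpos : 0 < K := rpow_pos_of_pos hε _
  have hθpos : 0 < θ := rpow_pos_of_pos hε _
  have htpos : 0 < t := rpow_pos_of_pos hε _
  have hε1 : ε ≤ 1 := by linarith
  have hw1 : 1 ≤ w := one_le_rpow_of_pos_of_le_one_of_nonpos hε hε1 (by norm_num)
  have ht1 : 1 ≤ t := one_le_rpow_of_pos_of_le_one_of_nonpos hε hε1 (by norm_num)
  have hθ2 : θ ≤ 1 / 2 := by
    have h1 : θ ^ 3 = ε ^ 2 := by
      rw [hθ, ← rpow_natCast, ← rpow_mul hε.le, ← rpow_natCast]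
      norm_num
    by_contra! h
    have h2 : (1 / 2 : ℝ) ^ 3 < θ ^ 3 := by gcongr
    have h3 : ε ^ 2 ≤ (1 / 8) ^ 2 := by gcongr
    linarith
  have hKθ : K * θ ^ 2 = 1 := by
    rw [hK, hθ, ← rpow_natCast, ← rpow_mul hε.le, ← rpow_add hε]
    norm_num
  have hθt : t * θ = 1 := by
    rw [ht, hθ, ← rpow_add hε]
    norm_num
  have hKε : K * ε ^ 2 * t = 1 := by
    rw [hK, ht, ← rpow_natCast ε 2, ← rpow_add hε, ← rpow_add hε]
    norm_num
  have hKε1 : 1 ≤ K * ε := by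
    rw [hK]
    nth_rw 2 [← rpow_one ε]
    rw [← rpow_add hε]
    exact one_le_rpow_of_pos_of_le_one_of_nonpos hε hε1 (by norm_num)
  -- `K ε ^ 2 w ^ 3 = 1` and `w ^ 9 ε ^ 2 = 1`, in the form in which they are needed
  have hwK : 1 ≤ (K * ε) * ε * w * w ^ 2 := by
    have h1 : (K * ε) * ε * w * w ^ 2 = 1 := by
      have : (K * ε) * ε * w * w ^ 2 = K * ε ^ 2 * w ^ 3 := by ring
      rw [this, hK, hw, ← rpow_natCast ε 2, ← rpow_natCast _ 3, ← rpow_mul hε.le, ← rpow_add hε,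
        ← rpow_add hε]
      norm_num
    exact h1.ge
  have hKX : K ≤ X ^ 2 := by
    have h1 : K ≤ (1 / ε) ^ 2 := by
      rw [hK, one_div, inv_pow, ← rpow_natCast ε 2, ← rpow_neg hε.le]
      exact rpow_le_rpow_of_exponent_ge hε hε1 (by norm_num)
    exact h1.trans (by gcongr)
  set μ : ℝ := ε / (8 * ℓ) with hμ
  have hμpos : 0 < μ := by positivity
  set r : ℝ := μ / 27 with hr
  have hrpos : 0 < r := by positivity
  have hr' : r = ε / (216 * ℓ) := by rw [hr, hμ]; field_simp; norm_num
  have hr1 : r ≤ 1 := by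
    rw [hr', div_le_one (by positivity)]; linarith
  have hμinv : 1 / μ = 8 * ℓ * (1 / ε) := by rw [hμ]; field_simp
  have hμX : 1 / μ ≤ X ^ 3 := by
    rw [hμinv]
    calc 8 * ℓ * (1 / ε) ≤ 8 * X * X := by gcongr
      _ = 8 * X ^ 2 := by ring
      _ ≤ X * X ^ 2 := by gcongr; linarith
      _ = X ^ 3 := by ring
  set lmin : ℝ := K / (2 * (160 / ε)) with hlmin
  have hlmin' : lmin = K * ε / 320 := by rw [hlmin]; field_simp; norm_num
  have hlminpos : 0 < lmin := by positivity
  have hlminX : 1 ≤ lmin * X ^ 3 := by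
    calc (1 : ℝ) ≤ 1 / 320 * X ^ 3 := by linarith
      _ ≤ K * ε / 320 * X ^ 3 := by gcongr
      _ = lmin * X ^ 3 := by rw [hlmin']
  set e₀ : ℝ := ε / (1000 * ℓ) with he₀
  have he₀pos : 0 < e₀ := by positivity
  have he₀X : 1 ≤ e₀ * X ^ 5 := by
    have h1 : 1 ≤ ε * X := by rwa [div_le_iff₀ hε, mul_comm] at hRX
    rw [he₀, div_mul_eq_mul_div, le_div_iff₀ (by positivity)]
    calc 1 * (1000 * ℓ) ≤ 1000 * X := by linarith
      _ ≤ X ^ 3 * X := by gcongr; linarith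
      _ ≤ (ε * X) * (X ^ 3 * X) := le_mul_of_one_le_left (by positivity) h1
      _ = ε * X ^ 5 := by ring
  set δ : ℝ := exp (-(5 * ℓ)) with hδdef
  have hδX : δ * X ^ 5 = 1 := by
    have h1 := hexp 5
    push_cast at h1
    rw [hδdef, ← h1, ← exp_add, neg_add_cancel, exp_zero]
  have hS2 := le_two_pow_ceil 11 ℓ
  have hS2' := two_pow_ceil_le (ℓ := ℓ) 11 (by linarith)
  have hNX := pow_ceil_mul_exp_le_one 69 ℓ
  rw [hexp] at hS2 hNX
  rw [show 2 * 11 + 1 = 23 from rfl, hexp] at hS2'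
  norm_num only at hS2 hS2' hNX
  have hT : (500000 * ℓ ^ 2 * t : ℝ) ≤ ⌈500000 * ℓ ^ 2 * t⌉₊ := Nat.le_ceil _
  have hT' : (⌈500000 * ℓ ^ 2 * t⌉₊ : ℝ) ≤ 600000 * ℓ ^ 2 * t := by
    refine (Nat.ceil_lt_add_one (by positivity)).le.trans ?_
    have : 1 ≤ ℓ ^ 2 * t := by
      calc (1 : ℝ) = 1 ^ 2 * 1 := by norm_num
        _ ≤ ℓ ^ 2 * t := by gcongr; linarith
    linarith
  have hwk : w ≤ (⌈w⌉₊ : ℝ) := Nat.le_ceil _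
  have hkpos : 0 < ⌈w⌉₊ := Nat.ceil_pos.2 hwpos
  refine solves_reg_game (K := K) (r := r) (e₀ := e₀) (Q := 12 / ε) (lmin := lmin) (δ := δ) (θ := θ)
    hμpos (by linarith) hc1 hθpos hθ2 hKθ hrpos (by rw [hr]; linarith) he₀pos.le ?_ hlminpos le_rfl
    ?_ ?_ hkpos ?_ ?_ ?_ ?_ ?_ ?_ ?_ ?_
  · rw [le_div_iff₀ hε]; linarith
  · rw [le_div_iff₀ hε]; linarith
  · have h1 : 10 / ε ≤ 12 / ε - 2 := by
      rw [← sub_nonneg]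
      have : 12 / ε - 2 - 10 / ε = 2 * (1 - ε) / ε := by field_simp; ring
      rw [this]
      have : 0 ≤ 1 - ε := by linarith
      positivity
    have hc0 : 0 ≤ c := le_trans (by positivity) hc
    calc (10 : ℝ) ≤ ε / 8 * (10 / ε) ^ 2 := by
          have : ε / 8 * (10 / ε) ^ 2 = 12.5 / ε := by field_simp; norm_num
          rw [this, le_div_iff₀ hε]; linarith
      _ ≤ c * (12 / ε - 2) ^ 2 := by gcongr
  · -- the Krylov dimension
    have hκ : √(1 + 1 / μ / (⌈w⌉₊ * lmin)) ≤ 51 * ℓ * w := by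
      rw [Real.sqrt_le_left (by positivity)]
      have h1 : 1 / μ / (⌈w⌉₊ * lmin) ≤ 2560 * ℓ * w ^ 2 := by
        rw [div_le_iff₀ (by positivity), hμinv, hlmin', mul_one_div, div_le_iff₀ hε]
        calc 8 * ℓ = 8 * ℓ * 1 := by ring
          _ ≤ 8 * ℓ * ((K * ε) * ε * w * w ^ 2) := by gcongr
          _ ≤ 8 * ℓ * ((K * ε) * ε * ⌈w⌉₊ * w ^ 2) := by gcongr
          _ = _ := by ring
      have h2 : 1 ≤ ℓ ^ 2 * w ^ 2 := by
        calc (1 : ℝ) = 1 ^ 2 * 1 ^ 2 := by norm_num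
          _ ≤ ℓ ^ 2 * w ^ 2 := by gcongr; linarith
      have h3 : ℓ * w ^ 2 ≤ ℓ ^ 2 * w ^ 2 := by
        gcongr
        exact le_self_pow₀ (by linarith) two_ne_zero
      calc 1 + 1 / μ / (⌈w⌉₊ * lmin) ≤ ℓ ^ 2 * w ^ 2 + 2560 * (ℓ ^ 2 * w ^ 2) := by linarith
        _ ≤ 2601 * (ℓ ^ 2 * w ^ 2) := by linarith [h2]
        _ = (51 * ℓ * w) ^ 2 := by ring
    have hj : 6 * ℓ ≤ ⌈306 * ℓ ^ 2 * w⌉₊ / √(1 + 1 / μ / (⌈w⌉₊ * lmin)) := by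
      rw [le_div_iff₀ (Real.sqrt_pos.2 (by positivity))]
      calc 6 * ℓ * √(1 + 1 / μ / (⌈w⌉₊ * lmin)) ≤ 6 * ℓ * (51 * ℓ * w) := by gcongr
        _ = 306 * ℓ ^ 2 * w := by ring
        _ ≤ _ := Nat.le_ceil _
    calc 2 * exp (-(⌈306 * ℓ ^ 2 * w⌉₊ / √(1 + 1 / μ / (⌈w⌉₊ * lmin)))) ≤
        exp ℓ * exp (-(6 * ℓ)) := by
          gcongr
          rw [hℓ, exp_log hXpos]; linarith
      _ = δ := by rw [hδdef, ← exp_add]; ring_nf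
  -- the accuracy of the linear solver
  · have hδpos : 0 < δ := exp_pos _
    have h1 : δ ^ 2 * X ^ 10 = 1 := by
      calc δ ^ 2 * X ^ 10 = (δ * X ^ 5) ^ 2 := by ring
        _ = 1 := by rw [hδX, one_pow]
    have h2 : 2048 * δ ^ 2 ≤ 1 := by
      calc 2048 * δ ^ 2 ≤ X ^ 10 * δ ^ 2 := by
            gcongr
            exact (by linarith : (2048 : ℝ) ≤ X ^ 4).trans (hmono (by norm_num))
        _ = 1 := by linarith
    have h3 : 2048 * δ ^ 2 * (1 / μ) ≤ lmin := by
      calc 2048 * δ ^ 2 * (1 / μ) ≤ X ^ 4 * δ ^ 2 * X ^ 3 * 1 := by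
            rw [mul_one]; gcongr; linarith
        _ ≤ X ^ 4 * δ ^ 2 * X ^ 3 * (lmin * X ^ 3) := by gcongr
        _ = lmin * (δ ^ 2 * X ^ 10) := by ring
        _ = lmin := by rw [h1, mul_one]
    have h4 : 2048 * δ ^ 2 * lmin ≤ 1 * lmin := by gcongr
    linarith
  -- the number of gradient steps per proximal parameter
  · have h25 : (25 : ℝ) ≤ X ^ 69 := (by linarith : (25 : ℝ) ≤ X ^ 2).trans (hmono (by norm_num))
    exact (mul_le_mul_of_nonneg_left h25 (by positivity)).trans hNX
  · have h1 : 1 ≤ (lmin * e₀) ^ 2 * X ^ 16 := by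
      calc (1 : ℝ) ≤ ((lmin * X ^ 3) * (e₀ * X ^ 5)) ^ 2 :=
            one_le_pow₀ (one_le_mul_of_one_le_of_one_le hlminX he₀X)
        _ = _ := by ring
    have h2 : (2 : ℝ) ^ ⌈22 * ℓ⌉₊ * K ≤ X ^ 25 := by
      calc (2 : ℝ) ^ ⌈22 * ℓ⌉₊ * K ≤ X ^ 23 * X ^ 2 := by gcongr
        _ = X ^ 25 := by ring
    have h3 : 1 / μ + 1 + 2 ^ ⌈22 * ℓ⌉₊ * K ≤ X ^ 26 := by
      have h4 : X ^ 3 ≤ X ^ 25 := hmono (by norm_num)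
      have h5 : 1 ≤ X ^ 25 := one_le_pow₀ hX1
      calc 1 / μ + 1 + 2 ^ ⌈22 * ℓ⌉₊ * K ≤ 11 * X ^ 25 := by linarith
        _ ≤ X * X ^ 25 := by gcongr
        _ = X ^ 26 := by ring
    have hr2 : r ^ 2 ≤ 1 := pow_le_one₀ hrpos.le hr1
    set E : ℝ := (63 / 64 : ℝ) ^ ⌈4416 * ℓ⌉₊
    have hE : 0 ≤ E := by positivity
    calc 100 * E * (2 ^ ⌈22 * ℓ⌉₊ * K) * r ^ 2 * (1 / μ + 1 + 2 ^ ⌈22 * ℓ⌉₊ * K)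
        ≤ X ^ 2 * E * X ^ 25 * 1 * X ^ 26 := by gcongr; linarith
      _ = E * X ^ 53 * 1 := by ring
      _ ≤ E * X ^ 53 * ((lmin * e₀) ^ 2 * X ^ 16) := by gcongr
      _ = (lmin * e₀) ^ 2 * (E * X ^ 69) := by ring
      _ ≤ (lmin * e₀) ^ 2 := mul_le_of_le_one_right (by positivity) hNX
  -- the number of halvings of the proximal parameter
  · have h1 : 1 + 12 / ε ≤ X ^ 3 := by
      have : 12 / ε = 12 * (1 / ε) := by ring
      rw [this]
      calc 1 + 12 * (1 / ε) ≤ 1 * X + 12 * X := by linarith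
        _ = 13 * X := by ring
        _ ≤ X ^ 2 * X := by gcongr; linarith
        _ = X ^ 3 := by ring
    have h2 : 1 ≤ r * X ^ 5 := by
      have h3 : 1 ≤ ε * X := by rwa [div_le_iff₀ hε, mul_comm] at hRX
      rw [hr', div_mul_eq_mul_div, le_div_iff₀ (by positivity)]
      calc 1 * (216 * ℓ) ≤ 216 * X := by linarith
        _ ≤ X ^ 3 * X := by gcongr; linarith
        _ ≤ (ε * X) * (X ^ 3 * X) := le_mul_of_one_le_left (by positivity) h3
        _ = ε * X ^ 5 := by ring
    calc 1 + 12 / ε ≤ X ^ 3 * 1 := by rw [mul_one]; exact h1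
      _ ≤ X ^ 3 * ((lmin * X ^ 3) * (r * X ^ 5)) := by
          gcongr
          exact one_le_mul_of_one_le_of_one_le hlminX h2
      _ = X ^ 11 * lmin * r := by ring
      _ ≤ _ := by gcongr
  · have h1 : X ^ 4 ≤ X ^ 8 := hmono (by norm_num)
    calc 1 / μ + 1 ≤ X ^ 3 + 1 := by linarith
      _ ≤ 2 * X ^ 3 := by linarith
      _ ≤ X * X ^ 3 := by gcongr; linarith
      _ = X ^ 4 := by ring
      _ ≤ X ^ 8 * 1 := by linarith
      _ ≤ X ^ 8 * (lmin * X ^ 3) := by gcongr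
      _ = X ^ 11 * lmin := by ring
      _ ≤ _ := by gcongr
  -- the number of accelerated steps
  · refine lt_of_lt_of_le ?_ hT
    have h1 : 10 / (K * r ^ 2) = 466560 * ℓ ^ 2 * t := by
      rw [hr', div_eq_iff (by positivity)]
      calc (10 : ℝ) = 10 * (K * ε ^ 2 * t) := by rw [hKε, mul_one]
        _ = _ := by field_simp; norm_num
    have h2 : log (160 / ε) ≤ 4 * ℓ := by
      have h3 : 160 / ε ≤ X ^ 4 := by
        calc 160 / ε = 160 * (1 / ε) := by ring
          _ ≤ X ^ 3 * X := by gcongr; linarith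
          _ = X ^ 4 := by ring
      rw [hℓ]
      calc log (160 / ε) ≤ log (X ^ 4) := log_le_log (by positivity) h3
        _ = 4 * log X := by rw [log_pow]; norm_num
    have h3 : log (160 / ε) / θ ≤ 4 * ℓ * t := by
      rw [div_le_iff₀ hθpos, mul_assoc, hθt, mul_one]
      exact h2
    have h4 : ℓ * t ≤ ℓ ^ 2 * t := by
      gcongr
      exact le_self_pow₀ (by linarith) two_ne_zero
    have h5 : 0 < ℓ ^ 2 * t := by positivity
    rw [h1]
    linarith
  -- the accumulated error of the proximal steps
  · calc (⌈500000 * ℓ ^ 2 * t⌉₊ : ℝ) * (K * e₀ ^ 2) ≤ 600000 * ℓ ^ 2 * t * (K * e₀ ^ 2) := by gcongr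
      _ = 600000 / 1000000 * (K * ε ^ 2 * t) := by rw [he₀]; field_simp; norm_num
      _ ≤ 1 := by rw [hKε]; norm_num

/-- The query complexity of the game for small `ε`. -/
lemma solves_game_of_le {ε : ℝ} (hε : 0 < ε) (hε8 : ε ≤ 1 / 8) :
    ∃ N : ℕ, (N : ℝ) ≤ 10 ^ 15 * ε ^ (-(8 / 9) : ℝ) * log (2 + m + n + 1 / ε) ^ 7 ∧
      Solves N fun (A : Matrix (Fin m) (Fin n) ℝ) z =>
        IsEpsSolution (unitBall n) (stdSimplex ℝ (Fin m)) (bilin A) ε z := by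
  set X : ℝ := 2 + m + n + 1 / ε with hXdef
  set ℓ := log X with hℓ
  have hm1 : (1 : ℝ) ≤ m := by exact_mod_cast NeZero.one_le (n := m)
  have hn0 : (0 : ℝ) ≤ n := Nat.cast_nonneg n
  have hR8 : 8 ≤ 1 / ε := by rw [le_div_iff₀ hε]; linarith
  have hX : 11 ≤ X := by linarith
  have hRX : 1 / ε ≤ X := by linarith
  have hmX : (m : ℝ) ≤ X := by linarith
  have hℓ2 : 2 ≤ ℓ := by
    rw [hℓ, Real.le_log_iff_exp_le (by linarith)]
    have h1 : exp 2 = exp 1 ^ 2 := by rw [← exp_nat_mul]; norm_num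
    rw [h1]
    have h2 := Real.exp_one_lt_d9
    have h3 := exp_pos 1
    nlinarith
  obtain ⟨J, hJ, hJ'⟩ := exists_two_pow_near hε (by linarith)
  have hsol := solves_game (m := m) (n := n) (μ := ε / (8 * ℓ)) (β := 1 / (160 / ε)) (by positivity)
    hε (by positivity) (by rw [one_div_div]) (by
      have h1 : log m ≤ ℓ := log_le_log (by linarith) hmX
      calc ε / (8 * ℓ) * log m ≤ ε / (8 * ℓ) * ℓ := by gcongr
        _ = ε / 8 := by field_simp) hJ hJ'
    (fun c hc hc1 => solves_reg_game_param hε hε8 hX hRX hℓ hℓ2 hc hc1)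
  refine ⟨_, ?_, hsol⟩
  set w : ℝ := ε ^ (-(2 / 9) : ℝ) with hw
  set t : ℝ := ε ^ (-(2 / 3) : ℝ) with ht
  have hwt : ε ^ (-(8 / 9) : ℝ) = w * t := by
    rw [hw, ht, ← rpow_add hε]; norm_num
  have hw1 : 1 ≤ w := one_le_rpow_of_pos_of_le_one_of_nonpos hε (by linarith) (by norm_num)
  have ht1 : 1 ≤ t := one_le_rpow_of_pos_of_le_one_of_nonpos hε (by linarith) (by norm_num)
  have hℓ1 : 1 ≤ ℓ := by linarith
  have hpow : ∀ a : ℕ, 1 ≤ ℓ ^ a := fun a => one_le_pow₀ hℓ1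
  have hJℓ : (J : ℝ) + 1 ≤ 5 * ℓ := by
    have h1 : (2 : ℝ) ^ J ≤ X ^ 2 := by
      refine hJ'.trans ?_
      calc 8 / ε = 8 * (1 / ε) := by ring
        _ ≤ X * X := by gcongr; linarith
        _ = X ^ 2 := by ring
    have h2 := log_le_log (by positivity) h1
    rw [log_pow, log_pow, ← hℓ] at h2
    push_cast at h2
    have h3 : (J : ℝ) * (1 / 2) ≤ J * log 2 := by
      gcongr
      linarith [Real.log_two_gt_d9]
    linarith
  have hk : (⌈w⌉₊ : ℝ) ≤ 2 * w := ceil_le_mul (by positivity) (by linarith)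
  have hℓ2w : 1 ≤ ℓ ^ 2 * w := one_le_mul_of_one_le_of_one_le (hpow 2) hw1
  have hj : (⌈306 * ℓ ^ 2 * w⌉₊ : ℝ) ≤ 307 * (ℓ ^ 2 * w) :=
    ceil_le_mul (by positivity) (by linarith)
  have hN : (⌈4416 * ℓ⌉₊ : ℝ) ≤ 4417 * ℓ := ceil_le_mul (by positivity) (by linarith)
  have hS : (⌈22 * ℓ⌉₊ : ℝ) ≤ 23 * ℓ := ceil_le_mul (by positivity) (by linarith)
  have hT : (⌈500000 * ℓ ^ 2 * t⌉₊ : ℝ) ≤ 500001 * (ℓ ^ 2 * t) :=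
    ceil_le_mul (by positivity)
      (by linarith [one_le_mul_of_one_le_of_one_le (hpow 2) ht1])
  have h1 : 2 + ((⌈w⌉₊ : ℝ) + ⌈306 * ℓ ^ 2 * w⌉₊) * 2 ≤ 620 * (ℓ ^ 2 * w) := by
    have : 1 * w ≤ ℓ ^ 2 * w := by gcongr; exact hpow 2
    linarith
  have h2 : ((⌈22 * ℓ⌉₊ : ℝ) + 1) * (⌈4416 * ℓ⌉₊ * (2 + ((⌈w⌉₊ : ℝ) + ⌈306 * ℓ ^ 2 * w⌉₊) * 2)) + 3 ≤
      70000000 * (ℓ ^ 4 * w) := by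
    calc _ ≤ (24 * ℓ) * ((4417 * ℓ) * (620 * (ℓ ^ 2 * w))) + 3 := by
          gcongr
          linarith
      _ = 65724960 * (ℓ ^ 4 * w) + 3 := by ring
      _ ≤ _ := by linarith [one_le_mul_of_one_le_of_one_le (hpow 4) hw1]
  have h3 : 1 + (⌈500000 * ℓ ^ 2 * t⌉₊ : ℝ) *
      (((⌈22 * ℓ⌉₊ : ℝ) + 1) * (⌈4416 * ℓ⌉₊ * (2 + ((⌈w⌉₊ : ℝ) + ⌈306 * ℓ ^ 2 * w⌉₊) * 2)) + 3) + 2 ≤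
      4 * 10 ^ 13 * (ℓ ^ 6 * (w * t)) := by
    calc _ ≤ 1 + 500001 * (ℓ ^ 2 * t) * (70000000 * (ℓ ^ 4 * w)) + 2 := by gcongr
      _ = 35000070000000 * (ℓ ^ 6 * (w * t)) + 3 := by ring
      _ ≤ _ := by
          linarith [one_le_mul_of_one_le_of_one_le (hpow 6) (one_le_mul_of_one_le_of_one_le hw1 ht1)]
  push_cast
  rw [hwt]
  calc _ ≤ (5 * ℓ) * (4 * 10 ^ 13 * (ℓ ^ 6 * (w * t))) := by gcongr
    _ = 2 * 10 ^ 14 * (w * t * ℓ ^ 7) := by ring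
    _ ≤ 10 ^ 15 * (w * t * ℓ ^ 7) := by gcongr; norm_num
    _ = _ := by ring

end Parameters

/-! ### The query complexity of the game -/

lemma IsEpsSolution.mono {m n : ℕ} {X : Set (Fin n → ℝ)} {Y : Set (Fin m → ℝ)}
    {f : (Fin n → ℝ) → (Fin m → ℝ) → ℝ} {ε ε' : ℝ} {z : (Fin n → ℝ) × (Fin m → ℝ)}
    (h : IsEpsSolution X Y f ε z) (hε : ε ≤ ε') : IsEpsSolution X Y f ε' z :=
  ⟨h.1, h.2.1, h.2.2.trans hε⟩

/-- For `ε ≥ 1` the origin and any mixed strategy form an `ε`-solution. -/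
lemma solves_game_zero {m n : ℕ} [NeZero m] {ε : ℝ} (hε : 1 ≤ ε) :
    Solves 0 fun (A : Matrix (Fin m) (Fin n) ℝ) z =>
      IsEpsSolution (unitBall n) (stdSimplex ℝ (Fin m)) (bilin A) ε z := by
  have hy : gibbs (fun _ : Fin m => (0 : EuclideanSpace ℝ (Fin n))) 1 0 ∈ stdSimplex ℝ (Fin m) :=
    ⟨gibbs_nonneg 0, sum_gibbs 0⟩
  set y := gibbs (fun _ : Fin m => (0 : EuclideanSpace ℝ (Fin n))) 1 0
  refine Solves.pure ((0 : EuclideanSpace ℝ (Fin n)).ofLp, y) (fun A hA => ?_) 0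
  refine isEpsSolution_of_forall_le (by simp) hy fun i => ?_
  rw [inner_zero_right, zero_add]
  refine le_trans ((norm_sum_le _ _).trans ?_) hε
  rw [← hy.2]
  refine sum_le_sum fun i _ => ?_
  rw [norm_smul, Real.norm_of_nonneg (hy.1 i)]
  exact mul_le_of_le_one_right (hy.1 i) (norm_rows_le hA i)

/-- The query complexity of the game for arbitrary `ε`. -/
lemma exists_alg_of_pos {m n : ℕ} (hm : 0 < m) {ε : ℝ} (hε : 0 < ε) :
    ∃ N : ℕ, (N : ℝ) ≤ 10 ^ 20 * ε ^ (-(8 / 9) : ℝ) * log (2 + m + n + 1 / ε) ^ 7 ∧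
      Solves N fun (A : Matrix (Fin m) (Fin n) ℝ) z =>
        IsEpsSolution (unitBall n) (stdSimplex ℝ (Fin m)) (bilin A) ε z := by
  have : NeZero m := ⟨hm.ne'⟩
  have hm1 : (1 : ℝ) ≤ m := by exact_mod_cast hm
  have hn0 : (0 : ℝ) ≤ n := Nat.cast_nonneg n
  have hRpos : 0 < 1 / ε := by positivity
  set X : ℝ := 2 + m + n + 1 / ε with hX
  have hX3 : 3 ≤ X := by linarith
  have hlog : 0 ≤ log X := log_nonneg (by linarith)
  rcases le_or_gt 1 ε with h1 | h1
  · exact ⟨0, by push_cast; positivity, solves_game_zero h1⟩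
  -- solve the game to the accuracy `min ε (1 / 8) ≥ ε / 8`
  set ε' := min ε (1 / 8) with hε'
  have hε'pos : 0 < ε' := lt_min hε (by norm_num)
  have hε'8 : ε / 8 ≤ ε' := le_min (by linarith) (by linarith)
  obtain ⟨N, hN, hsol⟩ := solves_game_of_le (m := m) (n := n) hε'pos (min_le_right _ _)
  refine ⟨N, hN.trans ?_, hsol.mono le_rfl fun A _ z hz => hz.mono (min_le_left _ _)⟩
  have h2 : ε' ^ (-(8 / 9) : ℝ) ≤ 8 * ε ^ (-(8 / 9) : ℝ) := by
    calc ε' ^ (-(8 / 9) : ℝ) ≤ (ε / 8) ^ (-(8 / 9) : ℝ) :=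
          rpow_le_rpow_of_nonpos (by positivity) hε'8 (by norm_num)
      _ = ε ^ (-(8 / 9) : ℝ) * 8 ^ (8 / 9 : ℝ) := by
          rw [div_rpow hε.le (by norm_num), rpow_neg (by norm_num : (0 : ℝ) ≤ 8), div_inv_eq_mul]
      _ ≤ ε ^ (-(8 / 9) : ℝ) * 8 := by
          gcongr
          calc (8 : ℝ) ^ (8 / 9 : ℝ) ≤ 8 ^ (1 : ℝ) :=
                rpow_le_rpow_of_exponent_le (by norm_num) (by norm_num)
            _ = 8 := rpow_one 8
      _ = _ := mul_comm _ _
  have h3 : log (2 + m + n + 1 / ε') ≤ 3 * log X := by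
    have h4 : 1 / ε' ≤ 8 * (1 / ε) := by
      calc 1 / ε' ≤ 1 / (ε / 8) := one_div_le_one_div_of_le (by positivity) hε'8
        _ = 8 * (1 / ε) := by rw [one_div_div]; ring
    have h5 : 2 + m + n + 1 / ε' ≤ X ^ 3 := by
      calc 2 + m + n + 1 / ε' ≤ 8 * X := by rw [hX]; linarith
        _ ≤ 3 ^ 2 * X := by linarith
        _ ≤ X ^ 2 * X := by gcongr
        _ = X ^ 3 := by ring
    have h6 : 0 < 2 + (m : ℝ) + n + 1 / ε' := by positivity
    calc log (2 + m + n + 1 / ε') ≤ log (X ^ 3) := log_le_log h6 h5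
      _ = 3 * log X := by rw [log_pow]; norm_num
  have h7 : 0 ≤ log (2 + m + n + 1 / ε') :=
    log_nonneg (by have : 0 < 1 / ε' := by positivity
                   linarith)
  calc 10 ^ 15 * ε' ^ (-(8 / 9) : ℝ) * log (2 + m + n + 1 / ε') ^ 7
      ≤ 10 ^ 15 * (8 * ε ^ (-(8 / 9) : ℝ)) * (3 * log X) ^ 7 := by gcongr
    _ = 17496 * 10 ^ 15 * (ε ^ (-(8 / 9) : ℝ) * log X ^ 7) := by ring
    _ ≤ 10 ^ 20 * (ε ^ (-(8 / 9) : ℝ) * log X ^ 7) := by gcongr; norm_num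
    _ = _ := by ring

end MatVecGame

theorem mainTheorem5 :
    ∃ alg : (m n : ℕ) → (ε : ℝ) →
        MatVecGame.OracleAlg m n ((Fin n → ℝ) × (Fin m → ℝ)),
      ∃ (C : ℝ) (k : ℕ), 0 < C ∧
        ∀ (m n : ℕ) (ε : ℝ), 0 < m → 0 < ε →
          ∀ A : Matrix (Fin m) (Fin n) ℝ, MatVecGame.twoToInftyNorm A ≤ 1 →
            MatVecGame.IsEpsSolution (MatVecGame.unitBall n) (stdSimplex ℝ (Fin m))
                (MatVecGame.bilin A) ε ((alg m n ε).result A) ∧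
              ((alg m n ε).numQueries A : ℝ) ≤
                C * ε ^ (-(8 / 9) : ℝ) * Real.log (2 + m + n + 1 / ε) ^ k := by
  have h : ∀ (m n : ℕ) (ε : ℝ),
      ∃ alg : MatVecGame.OracleAlg m n ((Fin n → ℝ) × (Fin m → ℝ)), 0 < m → 0 < ε →
        ∀ A : Matrix (Fin m) (Fin n) ℝ, MatVecGame.twoToInftyNorm A ≤ 1 →
          MatVecGame.IsEpsSolution (MatVecGame.unitBall n) (stdSimplex ℝ (Fin m))
              (MatVecGame.bilin A) ε (alg.result A) ∧
            (alg.numQueries A : ℝ) ≤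
              10 ^ 20 * ε ^ (-(8 / 9) : ℝ) * Real.log (2 + m + n + 1 / ε) ^ 7 := by
    intro m n ε
    by_cases hpos : 0 < m ∧ 0 < ε
    · obtain ⟨N, hN, alg, halg⟩ := MatVecGame.exists_alg_of_pos (n := n) hpos.1 hpos.2
      refine ⟨alg, fun _ _ A hA => ⟨(halg A hA).1, le_trans ?_ hN⟩⟩
      exact_mod_cast (halg A hA).2
    · exact ⟨.output 0, fun hm hε => absurd ⟨hm, hε⟩ hpos⟩
  choose alg halg using h
  exact ⟨alg, 10 ^ 20, 7, by norm_num, fun m n ε hm hε A hA => halg m n ε hm hε A hA⟩
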